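/- **Problem.** Let $T\ge 1$ and let $x_0\in\mathbb{R}^n$ be given. For $t=1,\dots,T$ let $\xi_t=(\Psi_t,b_t,(A_{t,\tau})_{0\le\tau\le t})$ be an interstage independent process with finite support: $\xi_1$ is deterministic (one realization, $M_1=1$), and for $t\ge 2$, $\xi_t$ takes the value $\xi_{t,j}=(\Psi_{t,j},b_{t,j},(A_{t,\tau,j})_\tau)$ with probability $\Phi_{t,j}>0$, $j=1,\dots,M_t$, $\sum_j\Phi_{t,j}=1$. Let $\mathcal X_t\subset\mathbb{R}^n$, let $f_t(x_{1:t},\Psi)$ and the components of $g_t(x_0,x_{1:t},\Psi)$ be extended-real-valued functions, and let $$X_t(x_{0:t-1},\xi_{t})=\Big\{x_t\in\mathcal X_t:\ g_t(x_{0:t},\Psi_t)\le 0,\ \sum_{\tau=0}^tA_{t,\tau}x_\tau=b_t\Big\}.$$ For $t=2,\dots,T$ let $\rho_t:\mathbb{R}^{M_t}\to\mathbb{R}$ be a coherent risk measure (monotone, translation equivariant, positively homogeneous, subadditive) and $\mathcal P_t=\{p\ge 0:\sum_jp_j\Phi_{t,j}=1,\ \sum_jp_j\Phi_{t,j}Z_j\le\rho_t(Z)\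 \forall Z\in\mathbb{R}^{M_t}\}$ its dual set, so that $\rho_t(Z)=\sup_{p\in\mathcal P_t}\sum_jp_j\Phi_{t,j}Z_j$; this formula is also used for extended-real-valued $Z$. Put $\mathcal Q_{T+1}\equiv 0$, $$\mathfrak Q_t(x_{1:t-1},\xi_{t,j})=\inf\{f_t(x_{1:t},\Psi_{t,j})+\mathcal Q_{t+1}(x_{1:t}):x_t\in X_t(x_{0:t-1},\xi_{t,j})\},\qquad \mathcal Q_t(x_{1:t-1})=\rho_t(\mathfrak Q_t(x_{1:t-1},\xi_t))\quad (2\le t\le T),$$ and let $\mathcal Q_1(x_0)=\mathfrak Q_1(x_0,\xi_1)=\inf\{f_1(x_1,\Psi_1)+\mathcal Q_2(x_1):x_1\in X_1(x_0,\xi_1)\}$ be the optimal value of the first stage problem. **Assumptions on the problem.** With $S^\varepsilon=S+\varepsilon\mathbb B$ ($\mathbb B$ the closed Euclidean unit ball), for $t=1,\dots,T$ and every $j$: 1. $\mathcal X_t$ is nonempty, convex and compact; 2. $f_t(x_{1:t},\cdot)$ is measurable for every $x_{1:t}$, and $f_t(\cdot,\Psi_{t,j})$ is proper, convex, lower semicontinuous;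 3. the components of $g_t(x_0,\cdot,\Psi_{t,j})$ are convex lower semicontinuous functions with values in $\mathbb{R}\cup\{+\infty\}$; 4. there is $\varepsilon>0$ (independent of $j$) such that $[\mathcal X_1\times\dots\times\mathcal X_{t-1}]^\varepsilon\times\mathcal X_t\subset\mathrm{dom}\,f_t(\cdot,\Psi_{t,j})$, and $X_t(x_{0:t-1},\xi_{t,j})\neq\emptyset$ for all $x_{1:t-1}\in[\mathcal X_1\times\dots\times\mathcal X_{t-1}]^\varepsilon$; 5. if $t\ge2$, there is $\bar x_{1:t}\in\mathcal X_1\times\dots\times\mathcal X_{t-1}\times\mathrm{ri}(\mathcal X_t)$ with $\bar x_{1:t}\in\mathrm{ri}(\{g_t(x_0,\cdot,\Psi_{t,j})\le0\})$ and $\bar x_t\in X_t(x_0,\bar x_{1:t-1},\xi_{t,j})$. **Algorithm.** In the scenario tree (a root of stage $0$, one node $n_1$ of stage $1$), $C(n)$ is the set of children of a node $n$; for a child $m$ of a node of stage $t-1$ corresponding to the realization $j$, write $\xi_m=\xi_{t,j}$, $\Psi_m=\Psi_{t,j}$, $\Phi_m=\Phi_{t,j}$, and denote by $A_{\tau,m}$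 and $b_m$ the components $A_{t,\tau,j}$ and $b_{t,j}$ of $\xi_m$. For decisions $x_n^k$ at the nodes, $x_{[n]}^k$ is the history of decisions from $n_1$ to $n$. Functions $$\mathcal Q_t^k(x_{1:t-1})=\max_{0\le\ell\le k}\Big(\theta_t^\ell+\langle\beta_t^\ell,x_{1:t-1}-x^\ell_{[n_{t-1}^\ell]}\rangle\Big)$$ are built, with $\theta_t^0=-\infty$, $\beta_t^0=0$ for $2\le t\le T$, and $\theta_{T+1}^k=0$, $\beta_{T+1}^k=0$ for all $k\ge0$. Let $\mathfrak Q_t^{k}$ be defined like $\mathfrak Q_t$ with $\mathcal Q_{t+1}$ replaced by $\mathcal Q_{t+1}^{k}$. At iteration $k\ge1$ a realization $\xi_t^k$ of each stage $t=2,\dots,T$ is sampled, which determines nodes $n_1^k=n_1,n_2^k,\dots,n_T^k$. For $t=1,\dots,T$, every node $n$ of stage $t-1$ and every $m\in C(n)$, $x_m^k$ is an optimal solution of $\inf\{f_t(x_{[n]}^k,x_t,\Psi_m)+\mathcal Q_{t+1}^{k-1}(x_{[n]}^k,x_t):x_t\in X_t(x_0,x_{[n]}^k,\xi_m)\}$.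 For $t=2,\dots,T$ and $n=n_{t-1}^k$, one chooses $p_k\in\mathcal P_t$ attaining $\sup_{p\in\mathcal P_t}\sum_{m\in C(n)}p_m\Phi_m\mathfrak Q_t^{k-1}(x^k_{[n]},\xi_m)$ and sets $$\theta_t^k=\sum_{m\in C(n)}p_{k,m}\Phi_m\mathfrak Q_t^{k-1}(x_{[n]}^k,\xi_m),\qquad \beta_t^k=\sum_{m\in C(n)}p_{k,m}\Phi_m\pi_{k,m}.$$ Here $\pi_{k,m}$ is given by optimal Lagrange multipliers: there are $\mu_i\ge0$ and $\kappa_\ell\ge 0$ ($0\le\ell\le k-1$, $\sum_\ell\kappa_\ell=1$), which vanish for the constraints $g_{t,i}\le 0$ and the cuts $\ell$ of $\mathcal Q_{t+1}^{k-1}$ not active at $x^k_{[m]}=(x_{[n]}^k,x_m^k)$, a vector $\lambda$, and subgradients $a\in\partial f_t(\cdot,\Psi_m)(x^k_{[m]})$, $c_i\in\partial g_{t,i}(x_0,\cdot,\Psi_m)(x^k_{[m]})$ (the latter for those $i$ with $\mu_i\neq 0$) in all variables $x_{1:t}$, such that $$a+\sum_i\mu_ic_i+[A_{1,m},\dots,A_{t,m}]^\top\lambda+\sum_{\ell=0}^{k-1}\kappa_\ell\beta_{t+1}^\ell=(\pi_{k,m},-\eta)$$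 for some $\eta\in\mathbb{R}^n$ in the normal cone to $\mathcal X_t$ at $x_m^k$. (If $\mathfrak Q_t^{k-1}(x_{[n]}^k,\xi_m)=-\infty$, which happens only in the first iterations, $\pi_{k,m}$ is arbitrary.) **Sampling.** For $k\ge1$ and $2\le t\le T$, $\mathbb P(\xi_t^k=\xi_{t,j})=\Phi_{t,j}$ (as indices of realizations), and $\xi_t^k$ is independent of all samples drawn before it, i.e. of $\sigma(\xi_2^1,\dots,\xi_T^1,\dots,\xi_2^{k-1},\dots,\xi_T^{k-1},\xi_2^k,\dots,\xi_{t-1}^k)$. The algorithm does not look ahead: the decisions $x_n^k$ are measurable with respect to the samples of iterations $1,\dots,k-1$, and $\theta_t^k,\beta_t^k$ with respect to those of iterations $1,\dots,k$. **Theorem 1 (Convergence analysis of Algorithm 1).** Under these assumptions, for all sequences generated by the algorithm: (i) almost surely, for every $t=2,\dots,T+1$ and every node $n$ of stage $t-1$, $\displaystyle\lim_{k\to+\infty}\mathcal Q_t(x_{[n]}^k)-\mathcal Q_t^k(x_{[n]}^k)=0$; (ii) almost surely, $\displaystyle\lim_{k\to+\infty}\mathfrak Q_1^k(x_0,\xi_1)=\mathcal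 Q_1(x_0)$; and if $f_1(\cdot,\Psi_1)$ is continuous on $\mathcal X_1$, then almost surely every accumulation point of the sequence $(x_{n_1}^k)_{k\ge1}$ of first stage decisions is an optimal solution of the first stage problem. -/

import Mathlib

open scoped Pointwise MeasureTheory

/-- The decision space `ℝⁿ` with its Euclidean norm (also used for the parameters `Ψ`). -/
abbrev Dec (n : ℕ) : Type := EuclideanSpace ℝ (Fin n)

/-- `(ℝⁿ)^s`, the space of decision histories `x_{1:s}`, with its Euclidean norm. -/
abbrev Hist (n s : ℕ) : Type := PiLp 2 (fun _ : Fin s => Dec n)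

namespace Hist

/-- `x_{1:s}` followed by `x_{s+1}`. -/
noncomputable def snoc {n s : ℕ} (h : Hist n s) (y : Dec n) : Hist n (s + 1) :=
  WithLp.toLp 2 (Fin.snoc (α := fun _ => Dec n) (fun i => h i) y)

/-- The first `s` blocks of an element of `(ℝⁿ)^(s+1)`. -/
noncomputable def past {n s : ℕ} (w : Hist n (s + 1)) : Hist n s :=
  WithLp.toLp 2 (fun i : Fin s => w i.castSucc)

/-- The last block of an element of `(ℝⁿ)^(s+1)`. -/
def last {n s : ℕ} (w : Hist n (s + 1)) : Dec n := w (Fin.last s)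

end Hist

section Convexity

variable {H : Type*} [NormedAddCommGroup H] [InnerProductSpace ℝ H]

/-- Convexity of an extended-real-valued function: its epigraph is convex. -/
def IsConvexFun (F : H → EReal) : Prop :=
  Convex ℝ {z : H × ℝ | F z.1 ≤ (z.2 : EReal)}

/-- `F` is proper: it never takes the value `-∞` and is not identically `+∞`. -/
def IsProperFun (F : H → EReal) : Prop :=
  (∀ w, F w ≠ ⊥) ∧ ∃ w, F w ≠ ⊤

/-- `a ∈ ∂F(w)`. -/
def IsSubgradient (F : H → EReal) (w a : H) : Prop :=
  ∀ w', F w + ((inner ℝ a (w' - w) : ℝ) : EReal) ≤ F w'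

/-- The `ε`-fattening `S + ε 𝔹` of a set. -/
def fattening (S : Set H) (ε : ℝ) : Set H := S + Metric.closedBall (0 : H) ε

end Convexity

section Risk

variable {ι : Type*} [Fintype ι]

/-- Coherent risk measures (for costs) on a finite probability space
all of whose atoms have positive probability. -/
structure IsCoherent (ρ : (ι → ℝ) → ℝ) : Prop where
  mono : ∀ Z Z' : ι → ℝ, (∀ j, Z j ≤ Z' j) → ρ Z ≤ ρ Z'
  translation : ∀ (Z : ι → ℝ) (c : ℝ), ρ (fun j => Z j + c) = ρ Z + c
  pos_homogeneous : ∀ (Z : ι → ℝ) (c : ℝ), 0 < c → ρ (fun j => c * Z j) = c * ρ Z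
  subadditive : ∀ Z Z' : ι → ℝ, ρ (fun j => Z j + Z' j) ≤ ρ Z + ρ Z'

/-- The dual set of `ρ`: the densities `p` with respect to `Φ`
whose expectation functional is dominated by `ρ`. -/
def riskEnvelope (Φ : ι → ℝ) (ρ : (ι → ℝ) → ℝ) : Set (ι → ℝ) :=
  {p | (∀ j, 0 ≤ p j) ∧ ∑ j, p j * Φ j = 1 ∧ ∀ Z : ι → ℝ, ∑ j, p j * Φ j * Z j ≤ ρ Z}

/-- `∑ j, p_j Φ_j Z_j` for extended-real-valued `Z`. -/
noncomputable def weightedSum (Φ p : ι → ℝ) (Z : ι → EReal) : EReal :=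
  ∑ j, ((p j * Φ j : ℝ) : EReal) * Z j

/-- The dual form of `ρ`, as a functional of extended-real-valued `Z`;
for real-valued `Z` it is `ρ Z`, see `extRisk_coe`. -/
noncomputable def extRisk (Φ : ι → ℝ) (ρ : (ι → ℝ) → ℝ) (Z : ι → EReal) : EReal :=
  ⨆ p ∈ riskEnvelope Φ ρ, weightedSum Φ p Z

/-- Dual representation: on real-valued `Z` the functional `extRisk Φ ρ` is `ρ`. -/
theorem extRisk_coe {Φ : ι → ℝ} (hΦ : ∀ j, 0 < Φ j) {ρ : (ι → ℝ) → ℝ} (hρ : IsCoherent ρ)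
    (Z : ι → ℝ) : extRisk Φ ρ (fun j => (Z j : EReal)) = (ρ Z : EReal) := by
  classical
  have hsum : ∀ p : ι → ℝ, weightedSum Φ p (fun j => (Z j : EReal))
      = ((∑ j, p j * Φ j * Z j : ℝ) : EReal) := by
    intro p
    unfold weightedSum
    have : ∀ s : Finset ι, ∑ j ∈ s, ((p j * Φ j : ℝ) : EReal) * (Z j : EReal)
        = ((∑ j ∈ s, p j * Φ j * Z j : ℝ) : EReal) := by
      intro s
      induction s using Finset.induction_on with
      | empty => simp
      | insert a s ha ih =>
        rw [Finset.sum_insert ha, Finset.sum_insert ha, ih, EReal.coe_add,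
          EReal.coe_mul (p a * Φ a) (Z a)]
    exact this Finset.univ
  unfold extRisk
  simp only [hsum]
  apply le_antisymm
  · exact iSup₂_le fun p hp => EReal.coe_le_coe_iff.2 (hp.2.2 Z)
  have h0 : ρ 0 = 0 := by
    have h := hρ.pos_homogeneous 0 2 (by norm_num)
    have e : (fun j : ι => (2 : ℝ) * (0 : ι → ℝ) j) = 0 := by funext j; simp
    rw [e] at h
    linarith
  have hhom : ∀ (c : ℝ), 0 < c → ∀ W : ι → ℝ, ρ (c • W) = c * ρ W := fun c hc W =>
    hρ.pos_homogeneous W c hc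
  have hsub : ∀ W W' : ι → ℝ, ρ (W + W') ≤ ρ W + ρ W' := hρ.subadditive
  obtain ⟨F, hF1, hF2⟩ : ∃ F : (ι → ℝ) →ₗ[ℝ] ℝ, F Z = ρ Z ∧ ∀ W, F W ≤ ρ W := by
    by_cases hZ : Z = 0
    · obtain ⟨F, -, hF⟩ := exists_extension_of_le_sublinear
        (⟨⊥, 0⟩ : (ι → ℝ) →ₗ.[ℝ] ℝ) ρ hhom hsub (by
          rintro ⟨x, hx⟩
          have hx' : x = 0 := by simpa using hx
          subst hx'
          simp [h0])
      exact ⟨F, by rw [hZ, h0, map_zero], hF⟩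
    · obtain ⟨F, hF1, hF⟩ := exists_extension_of_le_sublinear
        (LinearPMap.mkSpanSingleton Z (ρ Z) hZ) ρ hhom hsub (by
          rintro ⟨x, hx⟩
          have hx2 := hx
          rw [LinearPMap.domain_mkSpanSingleton, Submodule.mem_span_singleton] at hx2
          obtain ⟨c, rfl⟩ := hx2
          rw [LinearPMap.mkSpanSingleton'_apply]
          simp only [smul_eq_mul, RingHom.id_apply]
          rcases lt_trichotomy c 0 with hc | hc | hc
          · have h1 := hsub (c • Z) ((-c) • Z)
            have e : c • Z + (-c) • Z = 0 := by rw [← add_smul]; simp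
            rw [e, h0, hhom (-c) (by linarith)] at h1
            linarith
          · subst hc; simp [h0]
          · rw [hhom c hc])
      refine ⟨F, ?_, hF⟩
      have h1 := hF1 ⟨Z, by
        rw [LinearPMap.domain_mkSpanSingleton]; exact Submodule.mem_span_singleton_self Z⟩
      rw [h1]
      have h2 := LinearPMap.mkSpanSingleton_apply (σ := RingHom.id ℝ) ℝ ℝ hZ (ρ Z)
      exact h2
  have hrep : ∀ W : ι → ℝ, F W = ∑ j, F (Pi.single j 1) / Φ j * Φ j * W j := by
    intro W
    conv_lhs => rw [pi_eq_sum_univ' W]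
    rw [map_sum]
    refine Finset.sum_congr rfl fun j _ => ?_
    rw [map_smul, div_mul_cancel₀ _ (hΦ j).ne', smul_eq_mul, mul_comm]
  have hconst : ∀ c : ℝ, ρ (fun _ => c) = c := by
    intro c
    have h := hρ.translation 0 c
    rw [h0] at h
    simpa using h
  have hmem : (fun j => F (Pi.single j 1) / Φ j) ∈ riskEnvelope Φ ρ := by
    refine ⟨fun j => ?_, ?_, fun W => by rw [← hrep]; exact hF2 W⟩
    · refine div_nonneg ?_ (hΦ j).le
      have h1 := hF2 (-Pi.single j 1)
      have h2 : ρ (-Pi.single j 1) ≤ ρ 0 := hρ.mono _ _ fun i => by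
        by_cases h : i = j
        · subst h; simp
        · simp [h]
      rw [map_neg] at h1
      linarith
    · have h1 := hrep (fun _ => 1)
      simp only [mul_one] at h1
      rw [← h1]
      have h2 := hF2 (fun _ => 1)
      have h3 := hF2 (-(fun _ => 1))
      have e : (-(fun _ : ι => (1 : ℝ))) = fun _ => -1 := rfl
      rw [map_neg, e, hconst] at h3
      rw [hconst] at h2
      linarith
  refine le_trans (le_of_eq ?_) (le_iSup₂ (f := fun (p : ι → ℝ) (_ : p ∈ riskEnvelope Φ ρ) =>
    ((∑ j, p j * Φ j * Z j : ℝ) : EReal)) _ hmem)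
  rw [← hF1, hrep Z]

end Risk

/-- The data of a risk-averse multistage stochastic program with `T` stages and interstage
independent, finitely supported `ξ_t = (Ψ_t, b_t, (A_{t,τ})_τ)`.
Stages are numbered from `0`: the index `t : ℕ` stands for stage `t + 1`, and only `t < T` matters.
Stage `t + 1` has `M t` possible realizations, of probabilities `Φ t j`. -/
structure StochProgram where
  /-- number of stages -/
  T : ℕ
  /-- dimension of the decisions -/
  n : ℕ
  /-- number of realizations of each stage -/
  M : ℕ → ℕ
  /-- the first stage is deterministic -/
  M_zero : M 0 = 1
  /-- size of `Ψ` -/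
  d : ℕ → ℕ
  /-- number of inequality constraints -/
  p : ℕ → ℕ
  /-- number of equality constraints -/
  q : ℕ → ℕ
  /-- the given initial decision -/
  x₀ : Dec n
  /-- the sets to which decisions belong -/
  X : ℕ → Set (Dec n)
  /-- the realizations `Ψ_{t,j}` -/
  Ψ : (t : ℕ) → Fin (M t) → Dec (d t)
  /-- the cost functions `f_t(x_{1:t}, Ψ)` -/
  f : (t : ℕ) → Hist n (t + 1) → Dec (d t) → EReal
  /-- the components of the constraint functions `g_t(x_0, x_{1:t}, Ψ)` -/
  g : (t : ℕ) → Dec n → Hist n (t + 1) → Dec (d t) → Fin (p t) → EReal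
  /-- the realizations of the matrices; `A t j τ` multiplies `x_τ`, `τ = 0, 1, …` -/
  A : (t : ℕ) → Fin (M t) → ℕ → Matrix (Fin (q t)) (Fin n) ℝ
  /-- the realizations of the right-hand sides -/
  b : (t : ℕ) → Fin (M t) → Fin (q t) → ℝ
  /-- probabilities of the realizations -/
  Φ : (t : ℕ) → Fin (M t) → ℝ
  /-- risk measures -/
  ρ : (t : ℕ) → (Fin (M t) → ℝ) → ℝ

namespace StochProgram

variable (P : StochProgram)

/-- The index of the only realization of the first stage. -/
def j₁ : Fin (P.M 0) := ⟨0, by rw [P.M_zero]; exact Nat.one_pos⟩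

/-- The empty decision history. -/
noncomputable def h₀ : Hist P.n 0 := 0

/-- The feasible set of stage `t + 1` after the history `h`, for the realization `j`. -/
def feasible (t : ℕ) (j : Fin (P.M t)) (h : Hist P.n t) : Set (Dec P.n) :=
  {y | y ∈ P.X t ∧ (∀ i, P.g t P.x₀ (h.snoc y) (P.Ψ t j) i ≤ 0) ∧
    (P.A t j 0).mulVec P.x₀.ofLp
      + ∑ i : Fin (t + 1), (P.A t j (i + 1)).mulVec ((h.snoc y) i).ofLp = P.b t j}

/-- The objective `f_{t+1}(x_{1:t}, y, Ψ) + V(x_{1:t}, y)` of the problem of stage `t + 1`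
with (exact or approximate) recourse function `V`. -/
noncomputable def objective (t : ℕ) (V : Hist P.n (t + 1) → EReal) (j : Fin (P.M t))
    (h : Hist P.n t) (y : Dec P.n) : EReal :=
  P.f t (h.snoc y) (P.Ψ t j) + V (h.snoc y)

/-- The optimal value of the problem of stage `t + 1` with recourse function `V`. -/
noncomputable def stageValue (t : ℕ) (V : Hist P.n (t + 1) → EReal) (j : Fin (P.M t))
    (h : Hist P.n t) : EReal :=
  ⨅ y ∈ P.feasible t j h, P.objective t V j h y

/-- Recourse function of the history `x_{1:t}` when `r` stages remain. -/
noncomputable def recourseAux : ℕ → (t : ℕ) → Hist P.n t → EReal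
  | 0, _, _ => 0
  | r + 1, t, h =>
      extRisk (P.Φ t) (P.ρ t) (fun j => P.stageValue t (recourseAux r (t + 1)) j h)

/-- The recourse function `x_{1:t} ↦ 𝒬_{t+1}(x_{1:t})`, `1 ≤ t ≤ T`. -/
noncomputable def recourse (t : ℕ) : Hist P.n t → EReal := P.recourseAux (P.T - t) t

/-- Terminal condition of the dynamic programming equations. -/
theorem recourse_T (h : Hist P.n P.T) : P.recourse P.T h = 0 := by
  unfold recourse
  rw [Nat.sub_self]
  rfl

/-- The dynamic programming equations. -/
theorem recourse_of_lt {t : ℕ} (ht : t < P.T) (h : Hist P.n t) :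
    P.recourse t h =
      extRisk (P.Φ t) (P.ρ t) (fun j => P.stageValue t (P.recourse (t + 1)) j h) := by
  have e : P.T - t = (P.T - (t + 1)) + 1 := by omega
  unfold recourse
  rw [e]
  rfl

/-- The optimal value of the first stage problem. -/
noncomputable def optimalValue : EReal := P.stageValue 0 (P.recourse 1) P.j₁ P.h₀

/-- The realizations have positive probabilities that sum to one. -/
structure StageLaws : Prop where
  pos : ∀ t, 1 ≤ t → t < P.T → ∀ j, 0 < P.Φ t j
  sum_eq_one : ∀ t, 1 ≤ t → t < P.T → ∑ j, P.Φ t j = 1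

/-- `𝒳_1 × ⋯ × 𝒳_t`. -/
def histSet (t : ℕ) : Set (Hist P.n t) := {h | ∀ i : Fin t, h i ∈ P.X i}

/-- Convexity, compactness, relatively complete recourse and Slater-type conditions. -/
structure Regular : Prop where
  X_nonempty : ∀ t < P.T, (P.X t).Nonempty
  X_convex : ∀ t < P.T, Convex ℝ (P.X t)
  X_compact : ∀ t < P.T, IsCompact (P.X t)
  f_measurable : ∀ t < P.T, ∀ w, Measurable (fun ψ => P.f t w ψ)
  f_proper : ∀ t < P.T, ∀ j, IsProperFun (fun w => P.f t w (P.Ψ t j))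
  f_convex : ∀ t < P.T, ∀ j, IsConvexFun (fun w => P.f t w (P.Ψ t j))
  f_lsc : ∀ t < P.T, ∀ j, LowerSemicontinuous (fun w => P.f t w (P.Ψ t j))
  g_ne_bot : ∀ t < P.T, ∀ j i w, P.g t P.x₀ w (P.Ψ t j) i ≠ ⊥
  g_convex : ∀ t < P.T, ∀ j i, IsConvexFun (fun w => P.g t P.x₀ w (P.Ψ t j) i)
  g_lsc : ∀ t < P.T, ∀ j i, LowerSemicontinuous (fun w => P.g t P.x₀ w (P.Ψ t j) i)
  recourse : ∀ t < P.T, ∃ ε : ℝ, 0 < ε ∧ ∀ j, ∀ h ∈ fattening (P.histSet t) ε,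
    (∀ y ∈ P.X t, P.f t (h.snoc y) (P.Ψ t j) < ⊤) ∧ (P.feasible t j h).Nonempty
  slater : ∀ t, 1 ≤ t → t < P.T → ∀ j, ∃ (h : Hist P.n t) (y : Dec P.n),
    h ∈ P.histSet t ∧ y ∈ intrinsicInterior ℝ (P.X t) ∧
    h.snoc y ∈ intrinsicInterior ℝ
      {w : Hist P.n (t + 1) | ∀ i, P.g t P.x₀ w (P.Ψ t j) i ≤ 0} ∧
    y ∈ P.feasible t j h

/-- Nodes of stage `t` of the scenario tree (the root for `t = 0`): the choices of the
realizations of stages `1, …, t`. The first stage has one realization, hence one node. -/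
abbrev Node (t : ℕ) : Type := (i : Fin t) → Fin (P.M i)

variable {P}

/-- The child of a node for the realization `j` of the next stage. -/
def Node.child {t : ℕ} (ν : P.Node t) (j : Fin (P.M t)) : P.Node (t + 1) :=
  Fin.snoc (α := fun i : Fin (t + 1) => Fin (P.M i)) ν j

/-- The ancestor of stage `i + 1` of a node of stage `t > i` (the node itself if `i + 1 = t`). -/
def Node.ancestor {t : ℕ} (ν : P.Node t) (i : Fin t) : P.Node (i + 1) :=
  fun l => ν ⟨l, lt_of_lt_of_le l.isLt i.isLt⟩

variable (P)

/-- The root of the tree. -/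
def root : P.Node 0 := fun i => i.elim0

/-- The only node of stage one. -/
def node₁ : P.Node 1 := Node.child P.root P.j₁

/-- What the decomposition algorithm produces along one sequence of samples. The first argument
is the number of the iteration (iterations are `1, 2, …`, and `0` is the initialization). -/
structure Run where
  /-- the index of the realization of stage `t + 1` sampled at iteration `k` -/
  S : ℕ → (t : ℕ) → Fin (P.M t)
  /-- the decisions at the nodes of stage `t + 1` -/
  x : ℕ → (t : ℕ) → P.Node (t + 1) → Dec P.n
  /-- the constant terms of the cuts for the recourse function of `x_{1:t}` -/
  θ : ℕ → ℕ → EReal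
  /-- the slopes of the cuts for the recourse function of `x_{1:t}` -/
  β : ℕ → (t : ℕ) → Hist P.n t

variable {P}

namespace Run

variable (R : P.Run)

/-- The history of the decisions of iteration `k` from the first stage to the node `ν`. -/
noncomputable def hist (k : ℕ) {t : ℕ} (ν : P.Node t) : Hist P.n t :=
  WithLp.toLp 2 (fun i : Fin t => R.x k i (ν.ancestor i))

/-- The node of stage `t` sampled at iteration `k`. -/
def node (k t : ℕ) : P.Node t := fun i => R.S k i

/-- The cut of iteration `l` for the recourse function of `x_{1:t}`. -/
noncomputable def cut (l t : ℕ) (h : Hist P.n t) : EReal :=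
  R.θ l t + ((inner ℝ (R.β l t) (h - R.hist l (R.node l t)) : ℝ) : EReal)

/-- The approximate recourse function `x_{1:t} ↦ 𝒬_{t+1}^k(x_{1:t})`. -/
noncomputable def approx (k t : ℕ) (h : Hist P.n t) : EReal :=
  (Finset.range (k + 1)).sup (fun l => R.cut l t h)

/-- `π` is the slope given by optimal Lagrange multipliers `μ`, `lam`, `κ` (of the inequality
constraints, the equality constraints and the cuts `0, …, k`) and subgradients of the cost and of
the constraint functions at the optimal solution `y` of the problem of stage `t + 1` with history
`h`, realization `j` and recourse function `approx k (t + 1)`: the vector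
`G` is an element of the subdifferential of the Lagrangian at `(h, y)`, minus its last block is
normal to the set `P.X t` at `y`, and `π` consists of its other blocks. -/
def IsMultiplierSlope (k t : ℕ) (j : Fin (P.M t)) (h : Hist P.n t) (y : Dec P.n)
    (π : Hist P.n t) : Prop :=
  ∃ (a : Hist P.n (t + 1)) (c : Fin (P.p t) → Hist P.n (t + 1))
    (μ : Fin (P.p t) → ℝ) (lam : Fin (P.q t) → ℝ) (κ : ℕ → ℝ) (G : Hist P.n (t + 1)),
    IsSubgradient (fun w => P.f t w (P.Ψ t j)) (h.snoc y) a ∧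
    (∀ i, 0 ≤ μ i ∧ (μ i ≠ 0 → P.g t P.x₀ (h.snoc y) (P.Ψ t j) i = 0 ∧
      IsSubgradient (fun w => P.g t P.x₀ w (P.Ψ t j) i) (h.snoc y) (c i))) ∧
    (∀ l ∈ Finset.range (k + 1), 0 ≤ κ l ∧
      (κ l ≠ 0 → R.cut l (t + 1) (h.snoc y) = R.approx k (t + 1) (h.snoc y))) ∧
    ∑ l ∈ Finset.range (k + 1), κ l = 1 ∧
    G = a + ∑ i, μ i • c i
        + WithLp.toLp 2 (fun i : Fin (t + 1) =>
            WithLp.toLp 2 ((P.A t j (i + 1)).transpose.mulVec lam))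
        + ∑ l ∈ Finset.range (k + 1), κ l • R.β l (t + 1) ∧
    (∀ y' ∈ P.X t, 0 ≤ inner ℝ G.last (y' - y)) ∧
    π = G.past

/-- The run obeys the rules of the algorithm. Iteration `k + 1` uses the recourse functions
`approx k`. As long as the optimal values are `-∞` there are no multipliers, the cut is the
constant `-∞`, and its slope is irrelevant. -/
structure Generated : Prop where
  init_θ : ∀ t, 1 ≤ t → t < P.T → R.θ 0 t = ⊥
  init_β : ∀ t, 1 ≤ t → t < P.T → R.β 0 t = 0
  terminal_θ : ∀ k, R.θ k P.T = 0
  terminal_β : ∀ k, R.β k P.T = 0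
  decision : ∀ k, ∀ t < P.T, ∀ (ν : P.Node t) (j : Fin (P.M t)),
    R.x (k + 1) t (ν.child j) ∈ P.feasible t j (R.hist (k + 1) ν) ∧
    IsMinOn (P.objective t (R.approx k (t + 1)) j (R.hist (k + 1) ν))
      (P.feasible t j (R.hist (k + 1) ν)) (R.x (k + 1) t (ν.child j))
  newCut : ∀ k t, 1 ≤ t → t < P.T →
    ∃ (π : Fin (P.M t) → Hist P.n t) (p : Fin (P.M t) → ℝ),
      (∀ j, P.stageValue t (R.approx k (t + 1)) j
          (R.hist (k + 1) (R.node (k + 1) t)) ≠ ⊥ →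
        R.IsMultiplierSlope k t j (R.hist (k + 1) (R.node (k + 1) t))
          (R.x (k + 1) t ((R.node (k + 1) t).child j)) (π j)) ∧
      p ∈ riskEnvelope (P.Φ t) (P.ρ t) ∧
      IsMaxOn (fun p' => weightedSum (P.Φ t) p' (fun j =>
          P.stageValue t (R.approx k (t + 1)) j (R.hist (k + 1) (R.node (k + 1) t))))
        (riskEnvelope (P.Φ t) (P.ρ t)) p ∧
      R.θ (k + 1) t = weightedSum (P.Φ t) p (fun j =>
          P.stageValue t (R.approx k (t + 1)) j (R.hist (k + 1) (R.node (k + 1) t))) ∧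
      R.β (k + 1) t = ∑ j, (p j * P.Φ t j) • π j

/-- The optimal value of the first stage problem with recourse function `approx k 1`. -/
noncomputable def firstValue (k : ℕ) : EReal :=
  P.stageValue 0 (R.approx k 1) P.j₁ P.h₀

end Run

section Sampling

variable {Ω : Type*} (R : Ω → P.Run)

/-- The σ-algebra generated by one sampled realization. -/
@[reducible] def sampleAlg (k t : ℕ) : MeasurableSpace Ω :=
  MeasurableSpace.comap (fun ω => (R ω).S k t) ⊤

/-- The σ-algebra generated by the samples of iterations `1, …, k`. -/
@[reducible] def iterAlg (k : ℕ) : MeasurableSpace Ω :=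
  ⨆ (k' : ℕ) (t : ℕ) (_ : 1 ≤ k' ∧ k' ≤ k ∧ 1 ≤ t ∧ t < P.T), sampleAlg R k' t

/-- The σ-algebra generated by the samples drawn before the one of iteration `k`, index `t`. -/
@[reducible] def pastAlg (k t : ℕ) : MeasurableSpace Ω :=
  ⨆ (k' : ℕ) (t' : ℕ) (_ : 1 ≤ k' ∧ 1 ≤ t' ∧ t' < P.T ∧ (k' < k ∨ (k' = k ∧ t' < t))),
    sampleAlg R k' t'

/-- Every sample has the law of its stage and is independent of the samples drawn before it. -/
structure IndependentSampling [MeasurableSpace Ω] (ℙ : MeasureTheory.Measure Ω) : Prop where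
  measurable : ∀ k t, 1 ≤ k → 1 ≤ t → t < P.T → Measurable (fun ω => (R ω).S k t)
  law : ∀ k t, 1 ≤ k → 1 ≤ t → t < P.T → ∀ j,
    ℙ {ω | (R ω).S k t = j} = ENNReal.ofReal (P.Φ t j)
  indep : ∀ k t, 1 ≤ k → 1 ≤ t → t < P.T →
    ProbabilityTheory.Indep (sampleAlg R k t) (pastAlg R k t) ℙ

/-- The algorithm does not look ahead: the decisions of an iteration are computed from the samples
of the previous iterations, its cuts from the samples of the iterations so far. -/
structure NonAnticipative : Prop where
  decision : ∀ k, ∀ t < P.T, ∀ ν : P.Node (t + 1),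
    Measurable[iterAlg R k] (fun ω => (R ω).x (k + 1) t ν)
  θ : ∀ k t, 1 ≤ t → t ≤ P.T → Measurable[iterAlg R k] (fun ω => (R ω).θ k t)
  β : ∀ k t, 1 ≤ t → t ≤ P.T → Measurable[iterAlg R k] (fun ω => (R ω).β k t)

end Sampling

end StochProgram

/-! Three facts carry the proof: the cuts lie below the recourse functions, a cut computed late is
nearly tight where it is computed, and every node is sampled often enough for this to reach all
decisions.

Validity (`cut_le_recourse`). Adding the subgradient inequalities of the cost, the active
constraints and the active cuts, weighted by the multipliers, gives an affine minorant of each stage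
value; weighting these by a density of the dual set gives a minorant of the risk.

Tightness (`isAsymptoticallyExact`). By relatively complete recourse, each recourse function is
finite and convex on a neighbourhood of the compact set of histories, hence continuous and bounded
near it. Going backward in the stages, if the approximation is nearly exact at the children of a
node, the next cut computed at that node is nearly tight there. Such a cut is also below a bounded
function on a ball of fixed radius, so its slope is bounded, and it remains nearly tight at all
nearby histories.

Sampling (`ae_isRevisited`). Whether the decisions at a node are far from those of its earlier
visits is known before the node is sampled, and the node is then drawn with a fixed positive
probability. By compactness only boundedly many visits can be far from all earlier ones. So the
probabilities of being far are summable, and Borel-Cantelli shows that decisions are eventually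
close to an earlier visit.

The first stage value is then squeezed between its approximations, and cluster points are optimal
because sublevel sets are closed. -/

namespace Hist

/-! ### Algebra of histories -/

variable {n s : ℕ}

@[simp] theorem snoc_castSucc (h : Hist n s) (y : Dec n) (i : Fin s) :
    (h.snoc y) i.castSucc = h i := by
  simp [snoc]

@[simp] theorem snoc_last (h : Hist n s) (y : Dec n) : (h.snoc y) (Fin.last s) = y := by
  simp [snoc]

theorem snoc_smul_add_smul (a b : ℝ) (h₁ h₂ : Hist n s) (y₁ y₂ : Dec n) :
    (a • h₁ + b • h₂).snoc (a • y₁ + b • y₂) = a • h₁.snoc y₁ + b • h₂.snoc y₂ := by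
  ext i : 1
  refine Fin.lastCases ?_ (fun i => ?_) i <;> simp

theorem snoc_add (h₁ h₂ : Hist n s) (y₁ y₂ : Dec n) :
    (h₁ + h₂).snoc (y₁ + y₂) = h₁.snoc y₁ + h₂.snoc y₂ := by
  simpa using snoc_smul_add_smul 1 1 h₁ h₂ y₁ y₂

theorem snoc_sub (h₁ h₂ : Hist n s) (y₁ y₂ : Dec n) :
    h₁.snoc y₁ - h₂.snoc y₂ = (h₁ - h₂).snoc (y₁ - y₂) := by
  ext i : 1
  refine Fin.lastCases ?_ (fun i => ?_) i <;> simp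

theorem inner_snoc (G : Hist n (s + 1)) (h : Hist n s) (y : Dec n) :
    inner ℝ G (h.snoc y) = (inner ℝ G.past h + inner ℝ G.last y : ℝ) := by
  simp [PiLp.inner_apply (𝕜 := ℝ) (f := fun _ : Fin (s + 1) => Dec n),
    PiLp.inner_apply (𝕜 := ℝ) (f := fun _ : Fin s => Dec n), Fin.sum_univ_castSucc, past, last]

theorem norm_snoc_zero (h : Hist n s) : ‖h.snoc 0‖ = ‖h‖ := by
  rw [PiLp.norm_eq_of_L2, PiLp.norm_eq_of_L2, Fin.sum_univ_castSucc]
  simp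

theorem continuous_snoc (h : Hist n s) : Continuous h.snoc := by
  refine (PiLp.continuous_toLp 2 _).comp (continuous_pi fun i => ?_)
  refine Fin.lastCases ?_ (fun i => ?_) i
  · simp only [Fin.snoc_last]
    exact continuous_id
  · simp only [Fin.snoc_castSucc]
    exact continuous_const

end Hist

/-! ### Convex functions and fattenings of sets -/

section Convexity

variable {H : Type*} [NormedAddCommGroup H]

theorem IsConvexFun.le_combo [InnerProductSpace ℝ H] {F : H → EReal}
    (hF : IsConvexFun F) {w₁ w₂ : H} {r₁ r₂ : ℝ}
    (h₁ : F w₁ ≤ r₁) (h₂ : F w₂ ≤ r₂) {a b : ℝ} (ha : 0 ≤ a) (hb : 0 ≤ b) (hab : a + b = 1) :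
    F (a • w₁ + b • w₂) ≤ ((a * r₁ + b * r₂ : ℝ) : EReal) :=
  hF (x := (w₁, r₁)) h₁ (y := (w₂, r₂)) h₂ ha hb hab

theorem fattening_mono (S : Set H) {r r' : ℝ} (h : r ≤ r') : fattening S r ⊆ fattening S r' :=
  Set.add_subset_add_left (Metric.closedBall_subset_closedBall h)

theorem subset_fattening (S : Set H) {r : ℝ} (h : 0 ≤ r) : S ⊆ fattening S r := fun x hx =>
  ⟨x, hx, 0, Metric.mem_closedBall_self h, add_zero x⟩

theorem Convex.fattening [InnerProductSpace ℝ H] {S : Set H} (hS : Convex ℝ S) (r : ℝ) :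
    Convex ℝ (fattening S r) :=
  hS.add (convex_closedBall 0 r)

theorem IsCompact.fattening [InnerProductSpace ℝ H] [FiniteDimensional ℝ H] {S : Set H}
    (hS : IsCompact S) (r : ℝ) :
    IsCompact (fattening S r) :=
  haveI := FiniteDimensional.proper ℝ H
  hS.add (isCompact_closedBall 0 r)

theorem fattening_subset_interior (S : Set H) {r r' : ℝ} (h : r < r') :
    fattening S r ⊆ interior (fattening S r') := by
  refine (Set.add_subset_add_left (Metric.closedBall_subset_ball h)).trans ?_
  exact interior_maximal (Set.add_subset_add_left Metric.ball_subset_closedBall)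
    Metric.isOpen_ball.add_left

/-- On `K` the function `F` is real-valued, convex and bounded below. -/
def IsRegularOn [InnerProductSpace ℝ H] (F : H → EReal) (K : Set H) : Prop :=
  ∃ φ : H → ℝ, ConvexOn ℝ K φ ∧ (∃ c : ℝ, ∀ h ∈ K, c ≤ φ h) ∧ ∀ h ∈ K, F h = φ h

theorem exists_le_of_lsc {F : H → EReal} (hF : LowerSemicontinuous F) (hb : ∀ w, F w ≠ ⊥)
    {K : Set H} (hK : IsCompact K) : ∃ m : ℝ, ∀ w ∈ K, (m : EReal) ≤ F w := by
  rcases K.eq_empty_or_nonempty with rfl | hne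
  · exact ⟨0, by simp⟩
  obtain ⟨w, -, hmin⟩ := (hF.lowerSemicontinuousOn K).exists_isMinOn hne hK
  -- If the minimum is `⊤`, its `toReal` is `0`, which is still a lower bound.
  exact ⟨(F w).toReal, fun w' hw' => (EReal.coe_toReal_le (hb w)).trans (hmin hw')⟩

end Convexity

/-! ### Risk functionals with extended-real arguments -/

section Risk

variable {ι : Type*} [Fintype ι]

theorem weightedSum_mono {Φ p : ι → ℝ} (hw : ∀ j, 0 ≤ p j * Φ j) {Z Z' : ι → EReal}
    (h : ∀ j, Z j ≤ Z' j) : weightedSum Φ p Z ≤ weightedSum Φ p Z' :=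
  Finset.sum_le_sum fun j _ => mul_le_mul_of_nonneg_left (h j) (EReal.coe_nonneg.2 (hw j))

theorem extRisk_mono {Φ : ι → ℝ} (hΦ : ∀ j, 0 < Φ j) (ρ : (ι → ℝ) → ℝ) {Z Z' : ι → EReal}
    (h : ∀ j, Z j ≤ Z' j) : extRisk Φ ρ Z ≤ extRisk Φ ρ Z' :=
  iSup₂_mono fun _ hp => weightedSum_mono (fun j => mul_nonneg (hp.1 j) (hΦ j).le) h

/-- An affine minorant of each `Z' j` gives an affine minorant of the weighted sum. -/
theorem weightedSum_add_le {Φ p : ι → ℝ} (hw : ∀ j, 0 ≤ p j * Φ j) {Z Z' : ι → EReal}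
    {r : ι → ℝ} (h : ∀ j, Z j ≠ ⊥ → Z j + (r j : EReal) ≤ Z' j) :
    weightedSum Φ p Z + ((∑ j, p j * Φ j * r j : ℝ) : EReal) ≤ weightedSum Φ p Z' := by
  classical
  -- In `EReal`, `⊥` absorbs even `⊤` in sums, so one entry `⊥` of positive weight settles the
  -- claim; entries of weight zero contribute `0` whatever their value.
  by_cases hbot : ∃ j, 0 < p j * Φ j ∧ Z j = ⊥
  · obtain ⟨j, hj, hZ⟩ := hbot
    have : weightedSum Φ p Z = ⊥ := by
      unfold weightedSum
      rw [← Finset.add_sum_erase _ _ (Finset.mem_univ j), hZ, EReal.coe_mul_bot_of_pos hj,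
        EReal.bot_add]
    rw [this, EReal.bot_add]
    exact bot_le
  · push Not at hbot
    have e : ((∑ j, p j * Φ j * r j : ℝ) : EReal)
        = ∑ j, ((p j * Φ j : ℝ) : EReal) * (r j : EReal) := by
      simp only [← EReal.coe_mul]
      exact map_sum (⟨⟨Real.toEReal, EReal.coe_zero⟩, EReal.coe_add⟩ : ℝ →+ EReal) _ _
    rw [e]
    unfold weightedSum
    rw [← Finset.sum_add_distrib]
    refine Finset.sum_le_sum fun j _ => ?_
    rcases (hw j).eq_or_lt with h0 | hpos
    · simp [← h0]
    · rw [← EReal.left_distrib_of_nonneg_of_ne_top (EReal.coe_nonneg.2 hpos.le)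
        (EReal.coe_ne_top _)]
      exact mul_le_mul_of_nonneg_left (h j (hbot j hpos)) (EReal.coe_nonneg.2 hpos.le)

namespace IsCoherent

theorem map_zero {ι : Type*} {ρ : (ι → ℝ) → ℝ} (hρ : IsCoherent ρ) : ρ 0 = 0 := by
  have h := hρ.pos_homogeneous 0 2 (by norm_num)
  have e : (fun j : ι => (2 : ℝ) * (0 : ι → ℝ) j) = 0 := by funext j; simp
  rw [e] at h
  linarith

theorem map_smul {ι : Type*} {ρ : (ι → ℝ) → ℝ} (hρ : IsCoherent ρ) {c : ℝ} (hc : 0 ≤ c)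
    (Z : ι → ℝ) : ρ (c • Z) = c * ρ Z := by
  rcases hc.eq_or_lt with rfl | hc
  · simp [hρ.map_zero]
  · exact hρ.pos_homogeneous Z c hc

theorem le_of_forall_le {ι : Type*} {ρ : (ι → ℝ) → ℝ} (hρ : IsCoherent ρ) {c : ℝ} {Z : ι → ℝ}
    (h : ∀ j, c ≤ Z j) : c ≤ ρ Z := by
  have h1 := hρ.translation 0 c
  have h2 := hρ.mono (fun j => (0 : ι → ℝ) j + c) Z (fun j => by simpa using h j)
  rw [hρ.map_zero] at h1
  linarith

theorem convexOn_comp {ι H : Type*} [NormedAddCommGroup H] [InnerProductSpace ℝ H] {K : Set H}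
    {ρ : (ι → ℝ) → ℝ} (hρ : IsCoherent ρ) (hK : Convex ℝ K) {ψ : ι → H → ℝ}
    (hψ : ∀ j, ConvexOn ℝ K (ψ j)) :
    ConvexOn ℝ K (fun h => ρ (fun j => ψ j h)) := by
  refine ⟨hK, fun x hx y hy a b ha hb hab => ?_⟩
  calc ρ (fun j => ψ j (a • x + b • y))
      ≤ ρ (fun j => (a • fun j => ψ j x) j + (b • fun j => ψ j y) j) :=
        hρ.mono _ _ fun j => (hψ j).2 hx hy ha hb hab
    _ ≤ ρ (a • fun j => ψ j x) + ρ (b • fun j => ψ j y) := hρ.subadditive _ _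
    _ = _ := by rw [hρ.map_smul ha, hρ.map_smul hb]; rfl

end IsCoherent

theorem IsRegularOn.extRisk {H : Type*} [NormedAddCommGroup H] [InnerProductSpace ℝ H]
    {K : Set H} (hK : Convex ℝ K) {Φ : ι → ℝ} (hΦ : ∀ j, 0 < Φ j) {ρ : (ι → ℝ) → ℝ}
    (hρ : IsCoherent ρ) {F : ι → H → EReal} (hF : ∀ j, IsRegularOn (F j) K) :
    IsRegularOn (fun h => _root_.extRisk Φ ρ (fun j => F j h)) K := by
  choose ψ hψ hbd heq using hF
  choose c hc using hbd
  obtain ⟨m, hm⟩ := (Set.finite_range c).bddBelow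
  refine ⟨_, hρ.convexOn_comp hK hψ, ⟨m, fun h hh => hρ.le_of_forall_le fun j =>
    (hm ⟨j, rfl⟩).trans (hc j h hh)⟩, fun h hh => ?_⟩
  rw [← extRisk_coe hΦ hρ]
  simp only [heq _ h hh]

end Risk

/-! ### Finiteness, convexity and continuity of the recourse functions -/

namespace StochProgram

variable {P : StochProgram}

/-- The linear part of the equality constraints. -/
noncomputable def eqMap (P : StochProgram) (t : ℕ) (j : Fin (P.M t)) :
    Hist P.n (t + 1) →ₗ[ℝ] (Fin (P.q t) → ℝ) where
  toFun w := ∑ i : Fin (t + 1), (P.A t j (i + 1)).mulVec (w i).ofLp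
  map_add' w w' := by simp [Matrix.mulVec_add, Finset.sum_add_distrib]
  map_smul' c w := by simp [Matrix.mulVec_smul, Finset.smul_sum]

theorem mem_feasible_iff {t : ℕ} {j : Fin (P.M t)} {h : Hist P.n t} {y : Dec P.n} :
    y ∈ P.feasible t j h ↔ y ∈ P.X t ∧ (∀ i, P.g t P.x₀ (h.snoc y) (P.Ψ t j) i ≤ 0) ∧
      (P.A t j 0).mulVec P.x₀.ofLp + P.eqMap t j (h.snoc y) = P.b t j := Iff.rfl

/-- Multipliers of the equality constraints see a vector only through `eqMap`, so they disappear on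
differences of feasible points. -/
theorem inner_transpose_mulVec (t : ℕ) (j : Fin (P.M t)) (lam : Fin (P.q t) → ℝ)
    (w : Hist P.n (t + 1)) :
    inner ℝ (WithLp.toLp 2 (fun i : Fin (t + 1) =>
      (WithLp.toLp 2 ((P.A t j (i + 1)).transpose.mulVec lam) : Dec P.n)) : Hist P.n (t + 1)) w
      = lam ⬝ᵥ P.eqMap t j w := by
  rw [PiLp.inner_apply (𝕜 := ℝ) (f := fun _ : Fin (t + 1) => Dec P.n)]
  simp only [eqMap, LinearMap.coe_mk, AddHom.coe_mk, dotProduct_sum]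
  refine Finset.sum_congr rfl fun i _ => ?_
  rw [EuclideanSpace.inner_eq_star_dotProduct, Matrix.mulVec_transpose, dotProduct_comm,
    Matrix.dotProduct_mulVec]
  simp

theorem feasible_combo (hreg : P.Regular) {t : ℕ} (ht : t < P.T) {j : Fin (P.M t)}
    {h₁ h₂ : Hist P.n t} {y₁ y₂ : Dec P.n} (h1 : y₁ ∈ P.feasible t j h₁)
    (h2 : y₂ ∈ P.feasible t j h₂) {a b : ℝ} (ha : 0 ≤ a) (hb : 0 ≤ b) (hab : a + b = 1) :
    a • y₁ + b • y₂ ∈ P.feasible t j (a • h₁ + b • h₂) := by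
  rw [mem_feasible_iff] at *
  refine ⟨hreg.X_convex t ht h1.1 h2.1 ha hb hab, fun i => ?_, ?_⟩
  · rw [Hist.snoc_smul_add_smul]
    simpa using (hreg.g_convex t ht j i).le_combo (r₁ := 0) (r₂ := 0) (h1.2.1 i) (h2.2.1 i)
      ha hb hab
  · rw [Hist.snoc_smul_add_smul, LinearMap.map_add, LinearMap.map_smul, LinearMap.map_smul,
      eq_sub_of_add_eq' h1.2.2, eq_sub_of_add_eq' h2.2.2, ← add_smul, hab, one_smul]
    abel

theorem histSet_eq (t : ℕ) : P.histSet t =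
    WithLp.toLp 2 '' (Set.univ.pi fun i : Fin t => P.X i) := by
  ext h
  refine ⟨fun hh => ⟨h.ofLp, fun i _ => hh i, rfl⟩, ?_⟩
  rintro ⟨g, hg, rfl⟩ i
  exact hg i trivial

theorem convex_histSet (hreg : P.Regular) {t : ℕ} (ht : t ≤ P.T) : Convex ℝ (P.histSet t) :=
  fun _ hx _ hy _ _ ha hb hab i =>
    hreg.X_convex i (i.2.trans_le ht) (hx i) (hy i) ha hb hab

theorem isCompact_histSet (hreg : P.Regular) {t : ℕ} (ht : t ≤ P.T) :
    IsCompact (P.histSet t) := by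
  rw [histSet_eq]
  exact (isCompact_univ_pi fun i : Fin t => hreg.X_compact i (i.2.trans_le ht)).image
    (PiLp.continuous_toLp 2 _)

theorem snoc_mem_histSet {t : ℕ} {h : Hist P.n t} (hh : h ∈ P.histSet t) {y : Dec P.n}
    (hy : y ∈ P.X t) : h.snoc y ∈ P.histSet (t + 1) := fun i => by
  refine Fin.lastCases ?_ (fun i => ?_) i
  · simpa using hy
  · simpa using hh i

/-- The perturbation of the history is padded with a zero block, which keeps its norm; hence one
radius serves all stages. -/
theorem snoc_mem_fattening {t : ℕ} {r : ℝ} {h : Hist P.n t}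
    (hh : h ∈ fattening (P.histSet t) r) {y : Dec P.n} (hy : y ∈ P.X t) :
    h.snoc y ∈ fattening (P.histSet (t + 1)) r := by
  obtain ⟨h', hh', e, he, rfl⟩ := hh
  refine ⟨h'.snoc y, snoc_mem_histSet hh' hy, e.snoc 0, ?_, ?_⟩
  · simpa [Hist.norm_snoc_zero] using he
  · simp [← Hist.snoc_add]

theorem stageValue_mono (t : ℕ) {V V' : Hist P.n (t + 1) → EReal} (hV : ∀ w, V w ≤ V' w)
    (j : Fin (P.M t)) (h : Hist P.n t) : P.stageValue t V j h ≤ P.stageValue t V' j h :=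
  iInf₂_mono fun _ _ => add_le_add_right (hV _) _

/-- Partial minimization of a jointly convex function over a convex graph is convex. The value is
below `⊤` because a feasible decision exists, and bounded below because the cost is lower
semicontinuous on a compact set. -/
theorem IsRegularOn.stageValue (hreg : P.Regular) {t : ℕ} (ht : t < P.T) {r : ℝ}
    {j : Fin (P.M t)}
    (hr : ∀ h ∈ fattening (P.histSet t) r,
      (∀ y ∈ P.X t, P.f t (h.snoc y) (P.Ψ t j) < ⊤) ∧ (P.feasible t j h).Nonempty)
    {V : Hist P.n (t + 1) → EReal} (hV : IsRegularOn V (fattening (P.histSet (t + 1)) r)) :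
    IsRegularOn (P.stageValue t V j) (fattening (P.histSet t) r) := by
  obtain ⟨φ, hφ, ⟨c, hc⟩, hVφ⟩ := hV
  have hfb := (hreg.f_proper t ht j).1
  obtain ⟨m, hm⟩ := exists_le_of_lsc (hreg.f_lsc t ht j) hfb
    ((isCompact_histSet hreg (Nat.succ_le_of_lt ht)).fattening r)
  set F : Hist P.n (t + 1) → ℝ := fun w => (P.f t w (P.Ψ t j)).toReal with hF
  have hfF : ∀ h ∈ fattening (P.histSet t) r, ∀ y ∈ P.X t,
      P.f t (h.snoc y) (P.Ψ t j) = F (h.snoc y) := fun h hh y hy =>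
    (EReal.coe_toReal ((hr h hh).1 y hy).ne (hfb _)).symm
  have hobj : ∀ h ∈ fattening (P.histSet t) r, ∀ y ∈ P.X t,
      P.objective t V j h y = ((F (h.snoc y) + φ (h.snoc y) : ℝ) : EReal) := by
    intro h hh y hy
    rw [objective, hfF h hh y hy, hVφ _ (snoc_mem_fattening hh hy), EReal.coe_add]
  have hlow : ∀ h ∈ fattening (P.histSet t) r,
      ((m + c : ℝ) : EReal) ≤ P.stageValue t V j h := by
    intro h hh
    refine le_iInf₂ fun y hy => ?_
    rw [hobj h hh y hy.1]
    have h1 := hm _ (snoc_mem_fattening hh hy.1)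
    have h1' : (m : EReal) ≤ F (h.snoc y) := by rw [← hfF h hh y hy.1]; exact h1
    have h2 := hc _ (snoc_mem_fattening hh hy.1)
    exact EReal.coe_le_coe_iff.2 (add_le_add (EReal.coe_le_coe_iff.1 h1') h2)
  have hreal : ∀ h ∈ fattening (P.histSet t) r,
      P.stageValue t V j h = (P.stageValue t V j h).toReal := by
    intro h hh
    obtain ⟨y, hy⟩ := (hr h hh).2
    refine (EReal.coe_toReal ?_ ?_).symm
    · have h1 : P.stageValue t V j h ≤ P.objective t V j h y := iInf₂_le y hy
      rw [hobj h hh y hy.1] at h1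
      exact (h1.trans_lt (EReal.coe_lt_top _)).ne
    · exact ((EReal.bot_lt_coe _).trans_le (hlow h hh)).ne'
  have hconv : Convex ℝ (fattening (P.histSet t) r) :=
    (convex_histSet hreg ht.le).fattening r
  refine ⟨fun h => (P.stageValue t V j h).toReal, ⟨hconv, ?_⟩, ⟨m + c, fun h hh => ?_⟩, hreal⟩
  · intro h₁ hh₁ h₂ hh₂ a b ha hb hab
    have hh := hconv hh₁ hh₂ ha hb hab
    -- Decisions optimal up to `δ` suffice, so no minimizer is needed.
    have key : ∀ h ∈ fattening (P.histSet t) r, ∀ δ > 0, ∃ y ∈ P.feasible t j h,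
        F (h.snoc y) + φ (h.snoc y) < (P.stageValue t V j h).toReal + δ := by
      intro h hh δ hδ
      have h1 : P.stageValue t V j h < (((P.stageValue t V j h).toReal + δ : ℝ) : EReal) := by
        conv_lhs => rw [hreal h hh]
        exact EReal.coe_lt_coe_iff.2 (by linarith)
      obtain ⟨y, h2⟩ := iInf_lt_iff.1 h1
      obtain ⟨hy, hlt⟩ := iInf_lt_iff.1 h2
      rw [hobj h hh y hy.1] at hlt
      exact ⟨y, hy, EReal.coe_lt_coe_iff.1 hlt⟩
    refine le_of_forall_pos_le_add fun δ hδ => ?_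
    obtain ⟨y₁, hy₁, hlt₁⟩ := key h₁ hh₁ δ hδ
    obtain ⟨y₂, hy₂, hlt₂⟩ := key h₂ hh₂ δ hδ
    have hy := feasible_combo hreg ht hy₁ hy₂ ha hb hab
    have h1 : P.stageValue t V j (a • h₁ + b • h₂) ≤ P.objective t V j _ _ :=
      iInf₂_le (a • y₁ + b • y₂) hy
    rw [hobj _ hh _ hy.1, hreal _ hh, EReal.coe_le_coe_iff, Hist.snoc_smul_add_smul] at h1
    have h2 := hφ.2 (snoc_mem_fattening hh₁ hy₁.1) (snoc_mem_fattening hh₂ hy₂.1) ha hb hab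
    have h3 := (hreg.f_convex t ht j).le_combo (hfF h₁ hh₁ y₁ hy₁.1).le
      (hfF h₂ hh₂ y₂ hy₂.1).le ha hb hab
    have h4 := hfF _ hh _ hy.1
    rw [Hist.snoc_smul_add_smul] at h4
    rw [h4, EReal.coe_le_coe_iff] at h3
    simp only [smul_eq_mul] at h2 ⊢
    have h5 := mul_le_mul_of_nonneg_left hlt₁.le ha
    have h6 := mul_le_mul_of_nonneg_left hlt₂.le hb
    have h7 : a * δ + b * δ = δ := by rw [← add_mul, hab, one_mul]
    linarith
  · have := hlow h hh
    rw [hreal h hh, EReal.coe_le_coe_iff] at this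
    exact this

/-- A radius that serves in the recourse assumption of all the stages. -/
theorem exists_recourse_radius (hreg : P.Regular) : ∃ r : ℝ, 0 < r ∧ ∀ t < P.T, ∀ j,
    ∀ h ∈ fattening (P.histSet t) r,
      (∀ y ∈ P.X t, P.f t (h.snoc y) (P.Ψ t j) < ⊤) ∧ (P.feasible t j h).Nonempty := by
  have main : ∀ N ≤ P.T, ∃ r : ℝ, 0 < r ∧ ∀ t < N, ∀ j, ∀ h ∈ fattening (P.histSet t) r,
      (∀ y ∈ P.X t, P.f t (h.snoc y) (P.Ψ t j) < ⊤) ∧ (P.feasible t j h).Nonempty := by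
    intro N
    induction N with
    | zero => exact fun _ => ⟨1, one_pos, fun t ht => absurd ht (Nat.not_lt_zero t)⟩
    | succ N ih =>
      intro hN
      obtain ⟨r, hr, h1⟩ := ih (by omega)
      obtain ⟨ε, hε, h2⟩ := hreg.recourse N (by omega)
      refine ⟨min r ε, lt_min hr hε, fun t ht j h hh => ?_⟩
      rcases Nat.lt_succ_iff_lt_or_eq.1 ht with h' | rfl
      · exact h1 t h' j h (fattening_mono _ (min_le_left _ _) hh)
      · exact h2 j h (fattening_mono _ (min_le_right _ _) hh)
  exact main P.T le_rfl

theorem isRegularOn_recourse (hlaw : P.StageLaws)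
    (hρ : ∀ t, 1 ≤ t → t < P.T → IsCoherent (P.ρ t)) (hreg : P.Regular) {r : ℝ}
    (hr : ∀ t < P.T, ∀ j, ∀ h ∈ fattening (P.histSet t) r,
      (∀ y ∈ P.X t, P.f t (h.snoc y) (P.Ψ t j) < ⊤) ∧ (P.feasible t j h).Nonempty)
    {t : ℕ} (h1 : 1 ≤ t) (ht : t ≤ P.T) :
    IsRegularOn (P.recourse t) (fattening (P.histSet t) r) := by
  induction ht using Nat.decreasingInduction with
  | self =>
    exact ⟨fun _ => 0, convexOn_const 0 ((convex_histSet hreg le_rfl).fattening r),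
      ⟨0, fun _ _ => le_rfl⟩, fun h _ => by simp [P.recourse_T]⟩
  | of_succ t ht ih =>
    have := IsRegularOn.extRisk ((convex_histSet hreg ht.le).fattening r) (hlaw.pos t h1 ht)
      (hρ t h1 ht) fun j => IsRegularOn.stageValue hreg ht (hr t ht j) (ih (by omega))
    rwa [← funext (P.recourse_of_lt ht)] at this

/-- Near the set of the possible histories a recourse function is real-valued and bounded,
and it is continuous there. -/
theorem recourse_bounded_continuous (hlaw : P.StageLaws)
    (hρ : ∀ t, 1 ≤ t → t < P.T → IsCoherent (P.ρ t)) (hreg : P.Regular)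
    {t : ℕ} (h1 : 1 ≤ t) (ht : t ≤ P.T) : ∃ (φ : Hist P.n t → ℝ) (r c C : ℝ), 0 < r ∧
      (∀ h ∈ fattening (P.histSet t) r, P.recourse t h = φ h ∧ c ≤ φ h ∧ φ h ≤ C) ∧
      ContinuousOn φ (P.histSet t) := by
  obtain ⟨r, hr, hrec⟩ := exists_recourse_radius hreg
  obtain ⟨φ, hφ, ⟨c, hc⟩, heq⟩ := isRegularOn_recourse hlaw hρ hreg hrec h1 ht
  -- A finite convex function is continuous in the interior of its domain; halving the radius gives
  -- a compact set inside it, on which an upper bound exists too.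
  have hsub := fattening_subset_interior (P.histSet t) (half_lt_self hr)
  have hcont : ContinuousOn φ (fattening (P.histSet t) (r / 2)) :=
    hφ.continuousOn_interior.mono hsub
  obtain ⟨C, hC⟩ := (((isCompact_histSet hreg ht).fattening (r / 2)).image_of_continuousOn
    hcont).bddAbove
  exact ⟨φ, r / 2, c, C, half_pos hr, fun h hh => ⟨heq h (interior_subset (hsub hh)),
    hc h (interior_subset (hsub hh)), hC ⟨h, hh, rfl⟩⟩,
    hcont.mono (subset_fattening _ (half_pos hr).le)⟩

end StochProgram

/-! ### Validity of the cuts -/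

namespace StochProgram

variable {P : StochProgram}

theorem Node.eq_child {t : ℕ} (ν : P.Node (t + 1)) :
    ∃ (ν' : P.Node t) (j : Fin (P.M t)), ν = ν'.child j :=
  ⟨fun i => ν i.castSucc, ν (Fin.last t), (Fin.snoc_init_self ν).symm⟩

theorem Node.ancestor_child_castSucc {t : ℕ} (ν : P.Node t) (j : Fin (P.M t)) (i : Fin t) :
    (ν.child j).ancestor i.castSucc = ν.ancestor i :=
  funext fun l => Fin.snoc_castSucc (α := fun i : Fin (t + 1) => Fin (P.M i)) j ν
    ⟨l, lt_of_lt_of_le l.isLt i.isLt⟩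

namespace Run

variable {R : P.Run}

theorem hist_child (k : ℕ) {t : ℕ} (ν : P.Node t) (j : Fin (P.M t)) :
    R.hist k (ν.child j) = (R.hist k ν).snoc (R.x k t (ν.child j)) := by
  ext i : 1
  refine Fin.lastCases ?_ (fun i => ?_) i
  · rw [Hist.snoc_last]
    rfl
  · rw [Hist.snoc_castSucc]
    change R.x k i _ = R.x k i _
    rw [Node.ancestor_child_castSucc]

theorem cut_add (l t : ℕ) (w w' : Hist P.n t) :
    R.cut l t w' = R.cut l t w + ((inner ℝ (R.β l t) (w' - w) : ℝ) : EReal) := by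
  unfold cut
  rw [add_assoc, ← EReal.coe_add, ← inner_add_right]
  congr 4
  abel

theorem cut_le_approx {k l : ℕ} (hl : l ≤ k) (t : ℕ) (h : Hist P.n t) :
    R.cut l t h ≤ R.approx k t h :=
  Finset.le_sup (f := fun l => R.cut l t h) (Finset.mem_range.2 (by omega))

theorem approx_mono {k l : ℕ} (hl : l ≤ k) (t : ℕ) (h : Hist P.n t) :
    R.approx l t h ≤ R.approx k t h :=
  Finset.sup_mono (Finset.range_mono (by omega))

/-- Optimal multipliers give an affine minorant of the optimal value of a stage problem. -/
theorem IsMultiplierSlope.objective_add_le {k t : ℕ} {j : Fin (P.M t)} {h : Hist P.n t}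
    {y : Dec P.n} {π : Hist P.n t} (hs : R.IsMultiplierSlope k t j h y π)
    (hf : ∀ w, P.f t w (P.Ψ t j) ≠ ⊥) (hy : y ∈ P.feasible t j h)
    (hbot : R.approx k (t + 1) (h.snoc y) ≠ ⊥) (htop : R.approx k (t + 1) (h.snoc y) ≠ ⊤)
    {h' : Hist P.n t} {y' : Dec P.n} (hy' : y' ∈ P.feasible t j h') :
    P.objective t (R.approx k (t + 1)) j h y + ((inner ℝ π (h' - h) : ℝ) : EReal)
      ≤ P.objective t (R.approx k (t + 1)) j h' y' := by
  obtain ⟨a, c, μ, lam, κ, G, ha, hc, hκ, hsum, hG, hn, rfl⟩ := hs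
  unfold objective
  set w := h.snoc y with hw
  set w' := h'.snoc y' with hw'
  -- A cut with nonzero multiplier is active at `w`, so it is an affine minorant of the
  -- approximation, touching it at `w`.
  have hcut : ∀ l ∈ Finset.range (k + 1), κ l ≠ 0 → R.approx k (t + 1) w
      + ((inner ℝ (R.β l (t + 1)) (w' - w) : ℝ) : EReal) ≤ R.approx k (t + 1) w' := by
    intro l hl h0
    rw [← (hκ l hl).2 h0, ← cut_add]
    exact cut_le_approx (Nat.lt_succ_iff.1 (Finset.mem_range.1 hl)) _ _
  obtain ⟨v, hv⟩ : ∃ v : ℝ, R.approx k (t + 1) w = v := ⟨_, (EReal.coe_toReal htop hbot).symm⟩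
  rw [hv] at hcut ⊢
  -- The multipliers of the cuts sum to one, so at least one cut is active at `w`, and it is finite
  -- at `w'`.
  have hbot' : R.approx k (t + 1) w' ≠ ⊥ := by
    obtain ⟨l, hl, h0⟩ : ∃ l ∈ Finset.range (k + 1), κ l ≠ 0 := by
      by_contra! hcon
      rw [Finset.sum_eq_zero hcon] at hsum
      exact zero_ne_one hsum
    have := hcut l hl h0
    rw [← EReal.coe_add] at this
    exact ((EReal.bot_lt_coe _).trans_le this).ne'
  by_cases hf' : P.f t w' (P.Ψ t j) = ⊤
  · rw [hf', EReal.top_add_of_ne_bot hbot']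
    exact le_top
  by_cases hv' : R.approx k (t + 1) w' = ⊤
  · rw [hv', EReal.add_top_of_ne_bot (hf _)]
    exact le_top
  obtain ⟨v', hv'⟩ : ∃ v : ℝ, R.approx k (t + 1) w' = v :=
    ⟨_, (EReal.coe_toReal hv' hbot').symm⟩
  obtain ⟨F', hF'⟩ : ∃ F : ℝ, P.f t w' (P.Ψ t j) = F := ⟨_, (EReal.coe_toReal hf' (hf _)).symm⟩
  have hA := ha w'
  have hF : P.f t w (P.Ψ t j) ≠ ⊤ := by
    intro hcon
    simp only [hcon, hF'] at hA
    rw [EReal.top_add_coe] at hA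
    exact absurd (top_le_iff.1 hA) (EReal.coe_ne_top _)
  obtain ⟨F, hF⟩ : ∃ F : ℝ, P.f t w (P.Ψ t j) = F := ⟨_, (EReal.coe_toReal hF (hf _)).symm⟩
  simp only [hF, hF', ← EReal.coe_add, EReal.coe_le_coe_iff] at hA
  rw [hF, hF', hv', ← EReal.coe_add, ← EReal.coe_add, ← EReal.coe_add, EReal.coe_le_coe_iff]
  rw [hv'] at hcut
  have hB : ∑ i, μ i * inner ℝ (c i) (w' - w) ≤ 0 := by
    refine Finset.sum_nonpos fun i _ => ?_
    obtain ⟨hμ, hi⟩ := hc i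
    by_cases h0 : μ i = 0
    · simp [h0]
    · obtain ⟨hg, hsub⟩ := hi h0
      have h1 := (hsub w').trans (hy'.2.1 i)
      simp only [hg, zero_add] at h1
      exact mul_nonpos_of_nonneg_of_nonpos hμ (EReal.coe_nonpos.1 h1)
  have hC : P.eqMap t j (w' - w) = 0 := by
    rw [mem_feasible_iff] at hy hy'
    rw [map_sub, eq_sub_of_add_eq' hy.2.2, eq_sub_of_add_eq' hy'.2.2, sub_self]
  have hD : ∑ l ∈ Finset.range (k + 1), κ l * inner ℝ (R.β l (t + 1)) (w' - w) ≤ v' - v := by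
    calc ∑ l ∈ Finset.range (k + 1), κ l * inner ℝ (R.β l (t + 1)) (w' - w)
        ≤ ∑ l ∈ Finset.range (k + 1), κ l * (v' - v) := by
          refine Finset.sum_le_sum fun l hl => ?_
          by_cases h0 : κ l = 0
          · simp [h0]
          · have h1 := hcut l hl h0
            rw [← EReal.coe_add, EReal.coe_le_coe_iff] at h1
            exact mul_le_mul_of_nonneg_left (by linarith) (hκ l hl).1
      _ = v' - v := by rw [← Finset.sum_mul, hsum, one_mul]
  -- The pairing of `G` with `w' - w` is computed twice: by blocks, where the last one is
  -- nonnegative by normality, and by the terms of the Lagrangian subgradient.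
  have hE : inner ℝ G (w' - w) = inner ℝ G.past (h' - h) + inner ℝ G.last (y' - y) := by
    rw [hw, hw', Hist.snoc_sub, Hist.inner_snoc]
  have hI : inner ℝ G (w' - w) = inner ℝ a (w' - w) + ∑ i, μ i * inner ℝ (c i) (w' - w)
      + ∑ l ∈ Finset.range (k + 1), κ l * inner ℝ (R.β l (t + 1)) (w' - w) := by
    rw [hG, inner_add_left, inner_add_left, inner_add_left, inner_transpose_mulVec, hC,
      dotProduct_zero, add_zero, sum_inner, sum_inner]
    simp only [real_inner_smul_left]
  have hN := hn y' hy'.1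
  linarith

namespace Generated

theorem hist_mem_histSet (hR : R.Generated) (k : ℕ) {t : ℕ} (ht : t ≤ P.T) (ν : P.Node t) :
    R.hist (k + 1) ν ∈ P.histSet t := by
  induction t with
  | zero => exact fun i => i.elim0
  | succ t ih =>
    obtain ⟨ν, j, rfl⟩ := ν.eq_child
    rw [hist_child]
    exact snoc_mem_histSet (ih (by omega) ν) (hR.decision k t ht ν j).1.1

theorem stageValue_eq (hR : R.Generated) (k : ℕ) {t : ℕ} (ht : t < P.T) (ν : P.Node t)
    (j : Fin (P.M t)) :
    P.stageValue t (R.approx k (t + 1)) j (R.hist (k + 1) ν)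
      = P.objective t (R.approx k (t + 1)) j (R.hist (k + 1) ν) (R.x (k + 1) t (ν.child j)) :=
  le_antisymm (iInf₂_le _ (hR.decision k t ht ν j).1)
    (le_iInf₂ fun _ hy => (hR.decision k t ht ν j).2 hy)

theorem cut_T (hR : R.Generated) (l : ℕ) (h : Hist P.n P.T) : R.cut l P.T h = 0 := by
  simp [cut, hR.terminal_θ, hR.terminal_β]

theorem approx_T (hR : R.Generated) (k : ℕ) (h : Hist P.n P.T) : R.approx k P.T h = 0 := by
  refine le_antisymm (Finset.sup_le fun l _ => (hR.cut_T l h).le) ?_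
  rw [← hR.cut_T 0 h]
  exact cut_le_approx (Nat.zero_le k) _ _

/-- The cuts are valid. -/
theorem cut_le_recourse (hR : R.Generated) (hlaw : P.StageLaws)
    (hρ : ∀ t, 1 ≤ t → t < P.T → IsCoherent (P.ρ t)) (hreg : P.Regular) (l : ℕ) :
    ∀ t, 1 ≤ t → t ≤ P.T → ∀ h, R.cut l t h ≤ P.recourse t h := by
  -- The induction is on iterations, with all stages treated together: a cut of iteration `k + 1`
  -- rests on cuts of the next stage from iterations up to `k`.
  induction l using Nat.strong_induction_on with
  | _ l ih =>
  intro t h1 ht h'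
  rcases ht.eq_or_lt with rfl | ht
  · rw [hR.cut_T, P.recourse_T]
  rcases l with _ | k
  · unfold cut
    rw [hR.init_θ t h1 ht, EReal.bot_add]
    exact bot_le
  have hV : ∀ w, R.approx k (t + 1) w ≤ P.recourse (t + 1) w := fun w =>
    Finset.sup_le fun l hl => ih l (Finset.mem_range.1 hl) _ (by omega) ht w
  obtain ⟨π, p, hπ, hp, -, hθ, hβ⟩ := hR.newCut k t h1 ht
  set ν := R.node (k + 1) t
  have hle : ∀ j, P.stageValue t (R.approx k (t + 1)) j (R.hist (k + 1) ν) ≠ ⊥ →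
      P.stageValue t (R.approx k (t + 1)) j (R.hist (k + 1) ν)
        + ((inner ℝ (π j) (h' - R.hist (k + 1) ν) : ℝ) : EReal)
        ≤ P.stageValue t (R.approx k (t + 1)) j h' := by
    intro j hj
    refine le_iInf₂ fun y' hy' => ?_
    have hs := hπ j hj
    rw [hR.stageValue_eq k ht] at hj ⊢
    refine hs.objective_add_le (hreg.f_proper t ht j).1 (hR.decision k t ht ν j).1 ?_ ?_ hy'
    · intro hcon
      exact hj (by rw [objective, hcon, EReal.add_bot])
    · rw [← hist_child]
      obtain ⟨φ, r, c, C, hr, hφ, -⟩ :=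
        recourse_bounded_continuous hlaw hρ hreg (Nat.succ_pos t) ht
      refine ((hV _).trans_lt ?_).ne
      rw [(hφ _ (subset_fattening _ hr.le (hR.hist_mem_histSet k ht _))).1]
      exact EReal.coe_lt_top _
  calc R.cut (k + 1) t h'
      = weightedSum (P.Φ t) p (fun j =>
          P.stageValue t (R.approx k (t + 1)) j (R.hist (k + 1) ν))
        + ((∑ j, p j * P.Φ t j * inner ℝ (π j) (h' - R.hist (k + 1) ν) : ℝ) : EReal) := by
        unfold cut
        rw [hθ, hβ, sum_inner]
        simp only [real_inner_smul_left]
        rfl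
    _ ≤ weightedSum (P.Φ t) p (fun j => P.stageValue t (R.approx k (t + 1)) j h') :=
        weightedSum_add_le (fun j => mul_nonneg (hp.1 j) (hlaw.pos t h1 ht j).le) hle
    _ ≤ extRisk (P.Φ t) (P.ρ t) (fun j => P.stageValue t (R.approx k (t + 1)) j h') :=
        le_iSup₂ (f := fun (p : Fin (P.M t) → ℝ) (_ : p ∈ riskEnvelope (P.Φ t) (P.ρ t)) =>
          weightedSum (P.Φ t) p _) p hp
    _ ≤ P.recourse t h' := by
        rw [P.recourse_of_lt ht]
        exact extRisk_mono (hlaw.pos t h1 ht) _ fun j => stageValue_mono t hV j h'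

/-- The approximate recourse functions are minorants of the recourse functions. -/
theorem approx_le_recourse (hR : R.Generated) (hlaw : P.StageLaws)
    (hρ : ∀ t, 1 ≤ t → t < P.T → IsCoherent (P.ρ t)) (hreg : P.Regular) (k : ℕ) {t : ℕ}
    (h1 : 1 ≤ t) (ht : t ≤ P.T) (h : Hist P.n t) : R.approx k t h ≤ P.recourse t h :=
  Finset.sup_le fun l _ => hR.cut_le_recourse hlaw hρ hreg l t h1 ht h

end Generated

end Run

end StochProgram

/-! ### Asymptotic exactness at revisited nodes -/

theorem EReal.le_add_coe_iff_add_neg_le {a b : EReal} {η : ℝ} :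
    a ≤ b + (η : EReal) ↔ a + ((-η : ℝ) : EReal) ≤ b := by
  constructor <;> intro h
  · calc a + ((-η : ℝ) : EReal) ≤ b + (η : EReal) + ((-η : ℝ) : EReal) := add_le_add_left h _
      _ = b := by rw [add_assoc, ← EReal.coe_add]; simp
  · calc a = a + ((-η : ℝ) : EReal) + (η : EReal) := by rw [add_assoc, ← EReal.coe_add]; simp
      _ ≤ b + (η : EReal) := add_le_add_left h _

namespace StochProgram

variable {P : StochProgram}

namespace Run

variable {R : P.Run}

/-- The decisions at the node `ν` are approached by earlier decisions at `ν` of iterations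
in which `ν` has been sampled. -/
def IsRevisited (R : P.Run) {t : ℕ} (ν : P.Node t) : Prop :=
  ∀ N : ℕ, ∀ ε > 0, ∀ᶠ k in Filter.atTop, ∃ l, N ≤ l ∧ l < k ∧ R.node (l + 1) t = ν ∧
    dist (R.hist (k + 1) ν) (R.hist (l + 1) ν) < ε

/-- The approximation of the recourse function by the previous iterations becomes exact
at the decisions of the node `ν`. -/
def IsAsymptoticallyExact (R : P.Run) {t : ℕ} (ν : P.Node t) : Prop :=
  ∀ δ : ℝ, 0 < δ → ∀ᶠ k in Filter.atTop,
    P.recourse t (R.hist (k + 1) ν) ≤ R.approx k t (R.hist (k + 1) ν) + (δ : EReal)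

namespace Generated

/-- The computed decisions are feasible for the exact problems, so an error `η` at the children
costs at most `η` in each stage value. The risk does not amplify it, since the weights `p j * Φ j`
sum to one. -/
theorem recourse_le_θ_add (hR : R.Generated) (hlaw : P.StageLaws) {k t : ℕ} (h1 : 1 ≤ t)
    (ht : t < P.T) {η : ℝ}
    (hη : ∀ j, P.recourse (t + 1) (R.hist (k + 1) ((R.node (k + 1) t).child j))
      ≤ R.approx k (t + 1) (R.hist (k + 1) ((R.node (k + 1) t).child j)) + (η : EReal)) :
    P.recourse t (R.hist (k + 1) (R.node (k + 1) t)) ≤ R.θ (k + 1) t + (η : EReal) := by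
  obtain ⟨π, p, -, -, hmax, hθ, -⟩ := hR.newCut k t h1 ht
  set ν := R.node (k + 1) t
  have hj : ∀ j, P.stageValue t (P.recourse (t + 1)) j (R.hist (k + 1) ν) + ((-η : ℝ) : EReal)
      ≤ P.stageValue t (R.approx k (t + 1)) j (R.hist (k + 1) ν) := by
    intro j
    rw [← EReal.le_add_coe_iff_add_neg_le, hR.stageValue_eq k ht]
    refine (iInf₂_le _ (hR.decision k t ht ν j).1).trans ?_
    unfold objective
    rw [add_assoc, ← hist_child]
    exact add_le_add_right (hη j) _
  rw [P.recourse_of_lt ht, extRisk]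
  refine iSup₂_le fun p' hp' => ?_
  rw [EReal.le_add_coe_iff_add_neg_le]
  have h2 := weightedSum_add_le (fun j => mul_nonneg (hp'.1 j) (hlaw.pos t h1 ht j).le)
    fun j _ => hj j
  rw [← Finset.sum_mul, hp'.2.1, one_mul] at h2
  rw [hθ]
  exact h2.trans (hmax hp')

/-- If the decisions at all the nodes are revisited, then the approximations of the recourse
functions become exact at these decisions. -/
theorem isAsymptoticallyExact (hR : R.Generated) (hlaw : P.StageLaws)
    (hρ : ∀ t, 1 ≤ t → t < P.T → IsCoherent (P.ρ t)) (hreg : P.Regular)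
    (hrev : ∀ t ≤ P.T, ∀ ν : P.Node t, R.IsRevisited ν) {t : ℕ} (h1 : 1 ≤ t) (ht : t ≤ P.T)
    (ν : P.Node t) : R.IsAsymptoticallyExact ν := by
  induction ht using Nat.decreasingInduction with
  | self =>
    intro δ hδ
    refine Filter.Eventually.of_forall fun k => ?_
    rw [P.recourse_T, hR.approx_T, zero_add]
    exact EReal.coe_nonneg.2 hδ.le
  | of_succ t ht ih =>
  intro δ hδ
  obtain ⟨φ, r, c, C, hr, hφ, hcont⟩ := recourse_bounded_continuous hlaw hρ hreg h1 ht.le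
  have hφ' : ∀ k, P.recourse t (R.hist (k + 1) ν) = φ (R.hist (k + 1) ν) ∧
      c ≤ φ (R.hist (k + 1) ν) ∧ φ (R.hist (k + 1) ν) ≤ C := fun k =>
    hφ _ (subset_fattening _ hr.le (hR.hist_mem_histSet k ht.le ν))
  -- The bound `1` makes the slope estimate below independent of `δ`.
  set η := min (δ / 3) 1 with hη
  have hη0 : 0 < η := lt_min (by linarith) one_pos
  have hηδ : η ≤ δ / 3 := min_le_left _ _
  have hη1 : η ≤ 1 := min_le_right _ _
  obtain ⟨N, hN⟩ : ∃ N, ∀ k ≥ N, ∀ j, P.recourse (t + 1) (R.hist (k + 1) (ν.child j))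
      ≤ R.approx k (t + 1) (R.hist (k + 1) (ν.child j)) + (η : EReal) :=
    Filter.eventually_atTop.1 (Filter.eventually_all.2 fun j =>
      ih (Nat.succ_pos t) (ν.child j) η hη0)
  have hθ : ∀ l ≥ N, R.node (l + 1) t = ν → ∃ θ : ℝ, R.θ (l + 1) t = θ ∧
      φ (R.hist (l + 1) ν) - η ≤ θ ∧ r * ‖R.β (l + 1) t‖ ≤ C - c + 1 := by
    intro l hl hν
    have h2 := hR.recourse_le_θ_add hlaw (k := l) h1 ht (η := η) (by rw [hν]; exact hN l hl)
    have h3 := hR.cut_le_recourse hlaw hρ hreg (l + 1) t h1 ht.le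
    unfold cut at h3
    rw [hν] at h2 h3
    rw [(hφ' l).1] at h2
    have h4 := h3 (R.hist (l + 1) ν)
    rw [sub_self, inner_zero_right, EReal.coe_zero, add_zero, (hφ' l).1] at h4
    obtain ⟨θ, hθ⟩ : ∃ θ : ℝ, R.θ (l + 1) t = θ := by
      refine ⟨_, (EReal.coe_toReal (h4.trans_lt (EReal.coe_lt_top _)).ne fun hcon => ?_).symm⟩
      rw [hcon, EReal.bot_add] at h2
      exact absurd (le_bot_iff.1 h2) (EReal.coe_ne_bot _)
    rw [hθ, ← EReal.coe_add, EReal.coe_le_coe_iff] at h2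
    refine ⟨θ, hθ, by linarith, ?_⟩
    by_cases h0 : ‖R.β (l + 1) t‖ = 0
    · rw [h0, mul_zero]
      linarith [hφ' l]
    -- A step of length `r` along the slope raises the cut by `r * ‖β‖`; the cut starts above `c -
    -- 1` and stays below `C`.
    set e := (r / ‖R.β (l + 1) t‖) • R.β (l + 1) t with he
    have hmem : R.hist (l + 1) ν + e ∈ fattening (P.histSet t) r := by
      refine ⟨_, hR.hist_mem_histSet l ht.le ν, e, ?_, rfl⟩
      rw [mem_closedBall_zero_iff, he, norm_smul, norm_div, norm_norm,
        div_mul_cancel₀ _ h0, Real.norm_of_nonneg hr.le]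
    have h5 := h3 (R.hist (l + 1) ν + e)
    rw [add_sub_cancel_left, he, real_inner_smul_right, real_inner_self_eq_norm_mul_norm, ← he,
      (hφ _ hmem).1, hθ, ← EReal.coe_add, EReal.coe_le_coe_iff, ← mul_assoc,
      div_mul_cancel₀ _ h0] at h5
    linarith [(hφ _ hmem).2.2, (hφ' l).2.1]
  set L := |(C - c + 1) / r| with hL
  obtain ⟨ε₁, hε₁, huc⟩ := Metric.uniformContinuousOn_iff.1
    ((isCompact_histSet hreg ht.le).uniformContinuousOn_of_continuous hcont) (δ / 3)
    (by linarith)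
  have hL1 : 0 < L + 1 := by positivity
  -- The error `δ` is split into the tightness of the cut, the variation of `φ`, and the slope times
  -- the distance.
  set ε := min ε₁ (δ / 3 / (L + 1)) with hε
  have hε0 : 0 < ε := lt_min hε₁ (by positivity)
  filter_upwards [hrev t ht.le ν N ε hε0] with k ⟨l, hNl, hlk, hν, hd⟩
  obtain ⟨θ, hθ, hθφ, hβ⟩ := hθ l hNl hν
  -- Since `l < k`, the cut of iteration `l + 1` is already part of `approx k`.
  have h2 := cut_le_approx (R := R) (k := k) (l := l + 1) hlk t (R.hist (k + 1) ν)
  unfold cut at h2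
  rw [hν, hθ, ← EReal.coe_add] at h2
  refine le_trans ?_ (add_le_add_left h2 _)
  rw [(hφ' k).1, ← EReal.coe_add, EReal.coe_le_coe_iff]
  have h3 := huc _ (hR.hist_mem_histSet k ht.le ν) _ (hR.hist_mem_histSet l ht.le ν)
    (hd.trans_le (min_le_left _ _))
  rw [Real.dist_eq, abs_lt] at h3
  have h4 := abs_real_inner_le_norm (R.β (l + 1) t) (R.hist (k + 1) ν - R.hist (l + 1) ν)
  have h5 : ‖R.β (l + 1) t‖ ≤ L := by
    refine le_trans ?_ (le_abs_self _)
    rw [le_div_iff₀ hr]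
    linarith
  rw [← dist_eq_norm] at h4
  have h6 : ‖R.β (l + 1) t‖ * dist (R.hist (k + 1) ν) (R.hist (l + 1) ν) ≤ δ / 3 := by
    calc _ ≤ (L + 1) * (δ / 3 / (L + 1)) :=
          mul_le_mul (by linarith) (hd.le.trans (min_le_right _ _)) dist_nonneg hL1.le
      _ = δ / 3 := mul_div_cancel₀ _ hL1.ne'
  linarith [abs_le.1 (h4.trans h6)]

end Generated

end Run

end StochProgram

/-! ### Sampling: almost surely all nodes are revisited -/

namespace StochProgram

variable {P : StochProgram}

section Sampling

variable {Ω : Type*} {R : Ω → P.Run}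

theorem Node.ext_iff_init_last {t : ℕ} (ν : P.Node (t + 1)) (S : P.Run) (k : ℕ) :
    S.node k (t + 1) = ν ↔
      S.S k t = ν (Fin.last t) ∧ S.node k t = fun i : Fin t => ν i.castSucc := by
  constructor
  · rintro rfl
    exact ⟨rfl, rfl⟩
  · rintro ⟨h1, h2⟩
    funext i
    refine Fin.lastCases h1 (fun i => ?_) i
    exact congrFun h2 i

theorem subsingleton_fin_M_zero (P : StochProgram) : Subsingleton (Fin (P.M 0)) := by
  rw [P.M_zero]
  infer_instance

theorem measurableSet_node {k t : ℕ} {m : MeasurableSpace Ω}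
    (hm : ∀ i, 1 ≤ i → i < t → sampleAlg R k i ≤ m) (ν : P.Node t) :
    MeasurableSet[m] {ω | (R ω).node k t = ν} := by
  induction t with
  | zero =>
    have : {ω | (R ω).node k 0 = ν} = Set.univ :=
      Set.eq_univ_of_forall fun ω => funext fun i => i.elim0
    rw [this]
    exact MeasurableSet.univ
  | succ t ih =>
    simp only [Node.ext_iff_init_last]
    rw [Set.ofPred_and]
    refine MeasurableSet.inter ?_ (ih (fun i h1 h2 => hm i h1 (by omega)) _)
    -- The first stage is not sampled; its single realization makes the event the whole space.
    rcases t.eq_zero_or_pos with rfl | ht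
    · have := P.subsingleton_fin_M_zero
      have : {ω | (R ω).S k 0 = ν (Fin.last 0)} = Set.univ :=
        Set.eq_univ_of_forall fun ω => Subsingleton.elim _ _
      rw [this]
      exact MeasurableSet.univ
    · exact hm t ht (by omega) _ ⟨{ν (Fin.last t)}, trivial, rfl⟩

theorem sampleAlg_le_iterAlg {k k' t : ℕ} (h1 : 1 ≤ k') (hk : k' ≤ k) (ht : 1 ≤ t)
    (htT : t < P.T) : sampleAlg R k' t ≤ iterAlg R k :=
  le_iSup_of_le k' (le_iSup_of_le t (le_iSup_of_le ⟨h1, hk, ht, htT⟩ le_rfl))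

theorem sampleAlg_le_pastAlg {k k' t t' : ℕ} (h1 : 1 ≤ k') (ht : 1 ≤ t') (htT : t' < P.T)
    (h : k' < k ∨ (k' = k ∧ t' < t)) : sampleAlg R k' t' ≤ pastAlg R k t :=
  le_iSup_of_le k' (le_iSup_of_le t' (le_iSup_of_le ⟨h1, ht, htT, h⟩ le_rfl))

theorem iterAlg_mono {k l : ℕ} (h : l ≤ k) : iterAlg R l ≤ iterAlg R k :=
  iSup_le fun _ => iSup_le fun _ => iSup_le fun h' =>
    sampleAlg_le_iterAlg h'.1 (h'.2.1.trans h) h'.2.2.1 h'.2.2.2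

theorem iterAlg_le_pastAlg (k t : ℕ) : iterAlg R k ≤ pastAlg R (k + 1) t :=
  iSup_le fun _ => iSup_le fun _ => iSup_le fun h' =>
    sampleAlg_le_pastAlg h'.1 h'.2.2.1 h'.2.2.2 (Or.inl (Nat.lt_succ_of_le h'.2.1))

theorem NonAnticipative.measurable_dist_hist (hna : NonAnticipative R) {t : ℕ} (ht : t ≤ P.T)
    (ν : P.Node t) {k l : ℕ} (hl : l ≤ k) :
    Measurable[iterAlg R k]
      (fun ω => dist ((R ω).hist (k + 1) ν) ((R ω).hist (l + 1) ν)) := by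
  let _ : MeasurableSpace Ω := iterAlg R k
  have e : (fun ω => dist ((R ω).hist (k + 1) ν) ((R ω).hist (l + 1) ν)) = fun ω =>
      √(∑ i : Fin t, dist ((R ω).x (k + 1) i (ν.ancestor i))
        ((R ω).x (l + 1) i (ν.ancestor i)) ^ 2) := funext fun ω => PiLp.dist_eq_of_L2 _ _
  rw [e]
  refine Real.continuous_sqrt.measurable.comp (Finset.measurable_sum _ fun i _ => ?_)
  exact (Measurable.dist (hna.decision k i (i.2.trans_le ht) _)
    ((hna.decision l i (i.2.trans_le ht) _).mono (iterAlg_mono hl) le_rfl)).pow_const 2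

/-- The event that at iteration `k + 1` the decisions leading to `ν` are `ε`-far from those of
the earlier iterations, from `N + 1` on, in which `ν` has been sampled. -/
def farEvent (R : Ω → P.Run) {t : ℕ} (ν : P.Node t) (N : ℕ) (ε : ℝ) (k : ℕ) : Set Ω :=
  {ω | N ≤ k ∧ ∀ l, N ≤ l → l < k → (R ω).node (l + 1) t = ν →
    ε ≤ dist ((R ω).hist (k + 1) ν) ((R ω).hist (l + 1) ν)}

/-- Only the decisions up to iteration `k + 1` and the nodes sampled up to iteration `k` enter, so
the event is decided before iteration `k + 1` samples. -/
theorem NonAnticipative.measurableSet_farEvent (hna : NonAnticipative R) {t : ℕ}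
    (ht : t ≤ P.T) (ν : P.Node t) (N : ℕ) (ε : ℝ) (k : ℕ) :
    MeasurableSet[iterAlg R k] (farEvent R ν N ε k) := by
  have e : farEvent R ν N ε k = {_ω | N ≤ k} ∩ ⋂ l, ⋂ (_ : N ≤ l), ⋂ (_ : l < k),
      ({ω | (R ω).node (l + 1) t = ν}ᶜ ∪
        {ω | ε ≤ dist ((R ω).hist (k + 1) ν) ((R ω).hist (l + 1) ν)}) := by
    ext ω
    simp [farEvent, imp_iff_not_or]
  rw [e]
  refine (MeasurableSet.const _).inter (MeasurableSet.iInter fun l => MeasurableSet.iInter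
    fun _ => MeasurableSet.iInter fun hl => MeasurableSet.union ?_ ?_)
  · exact (measurableSet_node (fun i h1 h2 =>
      sampleAlg_le_iterAlg (by omega) hl h1 (by omega)) ν).compl
  · exact hna.measurable_dist_hist ht ν hl.le measurableSet_Ici

/-- Along one sequence of samples, the number of the iterations that sample `ν` with decisions far
from the earlier ones is at most a covering number of the set of the histories. -/
theorem exists_card_le_of_farEvent (hreg : P.Regular) (hrun : ∀ ω, (R ω).Generated) {t : ℕ}
    (ht : t ≤ P.T) (ν : P.Node t) (N : ℕ) {ε : ℝ} (hε : 0 < ε) :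
    ∃ C : ℕ, ∀ ω, ∀ s : Finset ℕ,
      (∀ k ∈ s, (R ω).node (k + 1) t = ν ∧ ω ∈ farEvent R ν N ε k) → s.card ≤ C := by
  obtain ⟨D, -, hD, hcov⟩ :=
    (isCompact_histSet hreg ht).finite_cover_balls (half_pos hε)
  refine ⟨hD.toFinset.card, fun ω s hs => ?_⟩
  have hcen : ∀ k, ∃ d ∈ D, dist ((R ω).hist (k + 1) ν) d < ε / 2 := by
    intro k
    have := hcov ((hrun ω).hist_mem_histSet k ht ν)
    simpa using this
  choose d hdD hd using hcen
  -- Two histories in the same ball of radius `ε / 2` are closer than `ε`, so two such iterations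
  -- never share a centre.
  have hlt : ∀ k ∈ s, ∀ l ∈ s, l < k → d l ≠ d k := by
    intro k hk l hl hlk heq
    have h1 := (hs k hk).2.2 l (hs l hl).2.1 hlk (hs l hl).1
    have h2 := hd k
    have h3 := hd l
    rw [heq] at h3
    linarith [dist_triangle_right ((R ω).hist (k + 1) ν) ((R ω).hist (l + 1) ν) (d k)]
  refine Finset.card_le_card_of_injOn d (fun k _ => hD.mem_toFinset.2 (hdD k)) ?_
  intro k hk l hl heq
  rcases lt_trichotomy k l with h | h | h
  · exact absurd heq (hlt l hl k hk h)
  · exact h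
  · exact absurd heq.symm (hlt k hk l hl h)

variable [mΩ : MeasurableSpace Ω] {ℙ : MeasureTheory.Measure Ω}

theorem IndependentSampling.iterAlg_le (hsamp : IndependentSampling R ℙ) (k : ℕ) :
    iterAlg R k ≤ mΩ :=
  iSup_le fun k' => iSup_le fun t => iSup_le fun h' =>
    (hsamp.measurable k' t h'.1 h'.2.2.1 h'.2.2.2).comap_le

/-- The node of an iteration is independent of the previous iterations,
and every node has a positive probability. -/
theorem IndependentSampling.exists_measure_node_inter (hsamp : IndependentSampling R ℙ)
    (hlaw : P.StageLaws) {t : ℕ} (ht : t ≤ P.T) (ν : P.Node t) :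
    ∃ c : ENNReal, c ≠ 0 ∧ ∀ k, ∀ B, MeasurableSet[iterAlg R k] B →
      ℙ ({ω | (R ω).node (k + 1) t = ν} ∩ B) = c * ℙ B := by
  induction t with
  | zero =>
    refine ⟨1, one_ne_zero, fun k B _ => ?_⟩
    have : {ω | (R ω).node (k + 1) 0 = ν} = Set.univ :=
      Set.eq_univ_of_forall fun ω => funext fun i => i.elim0
    rw [this, Set.univ_inter, one_mul]
  | succ t ih =>
    obtain ⟨c, hc, hcB⟩ := ih (by omega) (fun i : Fin t => ν i.castSucc)
    simp only [Node.ext_iff_init_last, Set.ofPred_and, Set.inter_assoc]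
    rcases t.eq_zero_or_pos with rfl | h1
    · refine ⟨c, hc, fun k B hB => ?_⟩
      have := P.subsingleton_fin_M_zero
      have : {ω | (R ω).S (k + 1) 0 = ν (Fin.last 0)} = Set.univ :=
        Set.eq_univ_of_forall fun ω => Subsingleton.elim _ _
      rw [this, Set.univ_inter]
      exact hcB k B hB
    · refine ⟨ENNReal.ofReal (P.Φ t (ν (Fin.last t))) * c, mul_ne_zero ?_ hc,
        fun k B hB => ?_⟩
      · exact (ENNReal.ofReal_pos.2 (hlaw.pos t h1 ht _)).ne'
      · have hS : MeasurableSet[sampleAlg R (k + 1) t]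
            {ω | (R ω).S (k + 1) t = ν (Fin.last t)} := ⟨{ν (Fin.last t)}, trivial, rfl⟩
        -- The last sampled realization is split off: the earlier ones of this iteration and `B` all
        -- belong to its past.
        rw [(ProbabilityTheory.Indep_iff _ _ _).1 (hsamp.indep (k + 1) t (by omega) h1 ht) _ _
          hS (MeasurableSet.inter (measurableSet_node (fun i hi1 hi2 =>
            sampleAlg_le_pastAlg (by omega) hi1 (by omega) (Or.inr ⟨rfl, hi2⟩)) _)
            (iterAlg_le_pastAlg k t _ hB)), hcB k B hB, mul_assoc]
        congr 1
        exact hsamp.law (k + 1) t (by omega) h1 ht _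

/-- The expected number of iterations that are far and sample `ν` is `c` times the sum of the
probabilities of being far, by independence. It is at most the pathwise bound `C`, so that sum is
finite and the first Borel-Cantelli lemma applies. -/
theorem ae_eventually_notMem_farEvent [MeasureTheory.IsProbabilityMeasure ℙ]
    (hlaw : P.StageLaws) (hreg : P.Regular) (hsamp : IndependentSampling R ℙ)
    (hna : NonAnticipative R) (hrun : ∀ ω, (R ω).Generated) {t : ℕ} (ht : t ≤ P.T)
    (ν : P.Node t) (N : ℕ) {ε : ℝ} (hε : 0 < ε) :
    ∀ᵐ ω ∂ℙ, ∀ᶠ k in Filter.atTop, ω ∉ farEvent R ν N ε k := by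
  classical
  refine MeasureTheory.ae_eventually_notMem ?_
  obtain ⟨c, hc, hcB⟩ := hsamp.exists_measure_node_inter hlaw ht ν
  obtain ⟨C, hC⟩ := exists_card_le_of_farEvent hreg hrun ht ν N hε
  have hbound : c * ∑' k, ℙ (farEvent R ν N ε k) ≤ C := by
    rw [← ENNReal.tsum_mul_left, ENNReal.tsum_eq_iSup_sum]
    refine iSup_le fun s => ?_
    set E : ℕ → Set Ω := fun k => {ω | (R ω).node (k + 1) t = ν} ∩ farEvent R ν N ε k with hE
    have hmeas : ∀ k, MeasurableSet (E k) := fun k =>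
      (measurableSet_node (fun i h1 h2 => (hsamp.measurable (k + 1) i (by omega) h1
        (by omega)).comap_le) ν).inter
        (hsamp.iterAlg_le k _ (hna.measurableSet_farEvent ht ν N ε k))
    calc ∑ k ∈ s, c * ℙ (farEvent R ν N ε k) = ∑ k ∈ s, ∫⁻ ω, (E k).indicator 1 ω ∂ℙ := by
          refine Finset.sum_congr rfl fun k _ => ?_
          rw [← hcB k _ (hna.measurableSet_farEvent ht ν N ε k),
            MeasureTheory.lintegral_indicator_one (hmeas k)]
      _ = ∫⁻ ω, ∑ k ∈ s, (E k).indicator 1 ω ∂ℙ :=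
          (MeasureTheory.lintegral_finsetSum _ fun k _ =>
            measurable_one.indicator (hmeas k)).symm
      _ ≤ ∫⁻ _, C ∂ℙ := by
          refine MeasureTheory.lintegral_mono fun ω => ?_
          have : ∑ k ∈ s, (E k).indicator (1 : Ω → ENNReal) ω
              = ((s.filter fun k => ω ∈ E k).card : ENNReal) := by
            rw [← Finset.sum_boole]
            exact Finset.sum_congr rfl fun k _ => Set.indicator_apply _ _ _
          rw [this]
          exact Nat.cast_le.2 (hC ω _ fun k hk => (Finset.mem_filter.1 hk).2)
      _ = C := by simp
  intro htop
  rw [htop, ENNReal.mul_top hc, top_le_iff] at hbound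
  exact ENNReal.natCast_ne_top C hbound

/-- Almost surely the decisions at all the nodes are revisited. -/
theorem ae_isRevisited [MeasureTheory.IsProbabilityMeasure ℙ]
    (hlaw : P.StageLaws) (hreg : P.Regular) (hsamp : IndependentSampling R ℙ)
    (hna : NonAnticipative R) (hrun : ∀ ω, (R ω).Generated) :
    ∀ᵐ ω ∂ℙ, ∀ t ≤ P.T, ∀ ν : P.Node t, (R ω).IsRevisited ν := by
  refine MeasureTheory.ae_all_iff.2 fun t => ?_
  by_cases ht : t ≤ P.T
  swap
  · exact Filter.Eventually.of_forall fun ω h => absurd h ht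
  -- Distances `1 / (m + 1)` leave only countably many almost sure events to intersect.
  have h := MeasureTheory.ae_all_iff.2 fun ν : P.Node t => MeasureTheory.ae_all_iff.2
    fun N : ℕ => MeasureTheory.ae_all_iff.2 fun m : ℕ =>
      ae_eventually_notMem_farEvent hlaw hreg hsamp hna hrun ht ν N
        (Nat.one_div_pos_of_nat (α := ℝ) (n := m))
  filter_upwards [h] with ω hω _ ν N ε hε
  obtain ⟨m, hm⟩ := exists_nat_one_div_lt hε
  filter_upwards [hω ν N m, Filter.eventually_ge_atTop N] with k hk hNk
  simp only [farEvent, Set.mem_ofPred_eq, hNk, true_and, not_forall, not_le] at hk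
  obtain ⟨l, h1, h2, h3, h4⟩ := hk
  exact ⟨l, h1, h2, h3, h4.trans hm⟩

end Sampling

end StochProgram

/-! ### Convergence of values and first stage decisions -/

namespace StochProgram

variable {P : StochProgram}

theorem continuous_eqMap (t : ℕ) (j : Fin (P.M t)) : Continuous (P.eqMap t j) := by
  change Continuous fun w : Hist P.n (t + 1) =>
    ∑ i : Fin (t + 1), (P.A t j (i + 1)).mulVec (w i).ofLp
  refine continuous_finsetSum _ fun i _ =>
    Continuous.matrix_mulVec (A := fun _ : Hist P.n (t + 1) => P.A t j (i + 1)) continuous_const ?_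
  exact (PiLp.continuous_ofLp 2 fun _ : Fin P.n => ℝ).comp
    ((continuous_apply i).comp (PiLp.continuous_ofLp 2 fun _ : Fin (t + 1) => Dec P.n))

theorem isClosed_feasible (hreg : P.Regular) {t : ℕ} (ht : t < P.T) (j : Fin (P.M t))
    (h : Hist P.n t) : IsClosed (P.feasible t j h) := by
  have hs := Hist.continuous_snoc h
  have e : P.feasible t j h = P.X t ∩
      ((⋂ i, {y | P.g t P.x₀ (h.snoc y) (P.Ψ t j) i ≤ 0}) ∩
        {y | (P.A t j 0).mulVec P.x₀.ofLp + P.eqMap t j (h.snoc y) = P.b t j}) := by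
    ext y
    simp [mem_feasible_iff]
  rw [e]
  refine (hreg.X_compact t ht).isClosed.inter ((isClosed_iInter fun i => ?_).inter ?_)
  · exact ((hreg.g_lsc t ht j i).isClosed_preimage 0).preimage hs
  · exact isClosed_eq (continuous_const.add
      ((continuous_eqMap t j).comp hs)) continuous_const

namespace Run

variable {R : P.Run}

namespace Generated

theorem tendsto_gap (hR : R.Generated) (hlaw : P.StageLaws)
    (hρ : ∀ t, 1 ≤ t → t < P.T → IsCoherent (P.ρ t)) (hreg : P.Regular) {t : ℕ} (h1 : 1 ≤ t)
    (ht : t ≤ P.T) {ν : P.Node t} (hν : R.IsAsymptoticallyExact ν) :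
    Filter.Tendsto (fun k => P.recourse t (R.hist k ν) - R.approx k t (R.hist k ν))
      Filter.atTop (nhds 0) := by
  obtain ⟨φ, r, c, C, hr, hφ, -⟩ := recourse_bounded_continuous hlaw hρ hreg h1 ht
  have hφ' : ∀ k, P.recourse t (R.hist (k + 1) ν) = φ (R.hist (k + 1) ν) := fun k =>
    (hφ _ (subset_fattening _ hr.le (hR.hist_mem_histSet k ht ν))).1
  -- Iteration `0` is only the initialization and its decisions are arbitrary.
  rw [← Filter.tendsto_add_atTop_iff_nat 1]
  refine tendsto_order.2 ⟨fun a ha => Filter.Eventually.of_forall fun k => ?_, fun b hb => ?_⟩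
  · refine ha.trans_le ?_
    have h2 := hR.approx_le_recourse hlaw hρ hreg (k + 1) h1 ht (R.hist (k + 1) ν)
    rw [hφ' k] at h2 ⊢
    exact (EReal.sub_nonneg (Or.inl (EReal.coe_ne_top _)) (Or.inl (EReal.coe_ne_bot _))).2 h2
  · obtain ⟨δ, hδ0, hδb⟩ := EReal.lt_iff_exists_real_btwn.1 hb
    filter_upwards [hν δ (EReal.coe_pos.1 hδ0)] with k hk
    refine lt_of_le_of_lt (EReal.sub_le_of_le_add ?_) hδb
    rw [add_comm (δ : EReal)]
    exact hk.trans (add_le_add_left (approx_mono (Nat.le_succ k) _ _) _)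

theorem firstValue_eq (hR : R.Generated) (hT : 1 ≤ P.T) (k : ℕ) :
    R.firstValue k = P.objective 0 (R.approx k 1) P.j₁ P.h₀ (R.x (k + 1) 0 P.node₁) := by
  have e : R.hist (k + 1) P.root = P.h₀ := Subsingleton.elim _ _
  have := hR.stageValue_eq k hT P.root P.j₁
  rwa [e] at this

theorem first_mem_feasible (hR : R.Generated) (hT : 1 ≤ P.T) (k : ℕ) :
    R.x (k + 1) 0 P.node₁ ∈ P.feasible 0 P.j₁ P.h₀ := by
  have e : R.hist (k + 1) P.root = P.h₀ := Subsingleton.elim _ _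
  have := (hR.decision k 0 hT P.root P.j₁).1
  rwa [e] at this

/-- The decision of iteration `k + 1` attains `firstValue k`, and passing to the exact recourse
function costs at most `δ`. With `firstValue_le` this makes it `δ`-optimal. -/
theorem objective_first_le (hR : R.Generated) (hT : 1 ≤ P.T)
    (hν : R.IsAsymptoticallyExact P.node₁) {δ : ℝ} (hδ : 0 < δ) : ∀ᶠ k in Filter.atTop,
      P.objective 0 (P.recourse 1) P.j₁ P.h₀ (R.x (k + 1) 0 P.node₁)
        ≤ R.firstValue k + (δ : EReal) := by
  filter_upwards [hν δ hδ] with k hk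
  have e : R.hist (k + 1) P.node₁ = P.h₀.snoc (R.x (k + 1) 0 P.node₁) := by
    rw [show P.h₀ = R.hist (k + 1) P.root from Subsingleton.elim _ _]
    exact hist_child _ _ _
  rw [hR.firstValue_eq hT]
  unfold objective
  rw [add_assoc]
  rw [e] at hk
  exact add_le_add_right hk _

theorem firstValue_le (hR : R.Generated) (hT : 1 ≤ P.T) (hlaw : P.StageLaws)
    (hρ : ∀ t, 1 ≤ t → t < P.T → IsCoherent (P.ρ t)) (hreg : P.Regular) (k : ℕ) :
    R.firstValue k ≤ P.optimalValue :=
  stageValue_mono 0 (hR.approx_le_recourse hlaw hρ hreg k le_rfl hT) _ _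

end Generated

end Run

theorem exists_optimalValue_eq (hT : 1 ≤ P.T) (hlaw : P.StageLaws)
    (hρ : ∀ t, 1 ≤ t → t < P.T → IsCoherent (P.ρ t)) (hreg : P.Regular) :
    ∃ v : ℝ, P.optimalValue = v := by
  obtain ⟨r, hr, hrec⟩ := exists_recourse_radius hreg
  obtain ⟨φ, -, -, hφ⟩ := IsRegularOn.stageValue hreg hT (hrec 0 hT P.j₁)
    (isRegularOn_recourse hlaw hρ hreg hrec le_rfl hT)
  exact ⟨_, hφ P.h₀ (subset_fattening _ hr.le fun i => i.elim0)⟩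

/-- The optimal value is at least `firstValue k`, and eventually at most `firstValue k + δ`, being
below the exact cost of the decision. -/
theorem Run.Generated.tendsto_firstValue {R : P.Run} (hR : R.Generated) (hT : 1 ≤ P.T)
    (hlaw : P.StageLaws) (hρ : ∀ t, 1 ≤ t → t < P.T → IsCoherent (P.ρ t)) (hreg : P.Regular)
    (hν : R.IsAsymptoticallyExact P.node₁) :
    Filter.Tendsto R.firstValue Filter.atTop (nhds P.optimalValue) := by
  obtain ⟨v, hv⟩ := exists_optimalValue_eq hT hlaw hρ hreg
  refine tendsto_order.2 ⟨fun a ha => ?_, fun b hb => Filter.Eventually.of_forall fun k =>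
    (hR.firstValue_le hT hlaw hρ hreg k).trans_lt hb⟩
  rw [hv] at ha
  obtain ⟨a', ha', hav⟩ := EReal.lt_iff_exists_real_btwn.1 ha
  filter_upwards [hR.objective_first_le hT hν (sub_pos.2 (EReal.coe_lt_coe_iff.1 hav))] with k hk
  have h1 : P.optimalValue ≤ _ := (iInf₂_le _ (hR.first_mem_feasible hT k)).trans hk
  rw [hv, EReal.le_add_coe_iff_add_neg_le, ← EReal.coe_add] at h1
  refine ha'.trans_le (le_trans (EReal.coe_le_coe_iff.2 ?_) h1)
  linarith

/-- Sublevel sets of the first stage problem are closed. -/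
theorem isClosed_first_sublevel (hT : 1 ≤ P.T) (hlaw : P.StageLaws)
    (hρ : ∀ t, 1 ≤ t → t < P.T → IsCoherent (P.ρ t)) (hreg : P.Regular) (a : ℝ) :
    IsClosed {y | y ∈ P.feasible 0 P.j₁ P.h₀ ∧
      P.objective 0 (P.recourse 1) P.j₁ P.h₀ y ≤ (a : EReal)} := by
  obtain ⟨φ, r, c, C, hr, hφ, hcont⟩ := recourse_bounded_continuous hlaw hρ hreg le_rfl hT
  have hmem : ∀ y ∈ P.feasible 0 P.j₁ P.h₀, P.h₀.snoc y ∈ P.histSet 1 := fun y hy =>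
    snoc_mem_histSet (fun i => i.elim0) hy.1
  have hs := Hist.continuous_snoc P.h₀
  -- With the continuous real-valued recourse term moved to the right, the sublevel set becomes a
  -- preimage of the epigraph of the cost, closed by lower semicontinuity.
  have hc : ContinuousOn (fun y => (P.h₀.snoc y, ((a - φ (P.h₀.snoc y) : ℝ) : EReal)))
      (P.feasible 0 P.j₁ P.h₀) :=
    hs.continuousOn.prodMk (continuous_coe_real_ereal.comp_continuousOn
      (continuousOn_const.sub (hcont.comp hs.continuousOn hmem)))
  have := hc.preimage_isClosed_of_isClosed (isClosed_feasible hreg hT _ _)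
    (hreg.f_lsc 0 hT P.j₁).isClosed_epigraph
  convert this using 1
  ext y
  refine and_congr_right fun hy => ?_
  rw [objective, (hφ _ (subset_fattening _ hr.le (hmem y hy))).1]
  change _ ↔ P.f 0 (P.h₀.snoc y) (P.Ψ 0 P.j₁) ≤ ((a - φ (P.h₀.snoc y) : ℝ) : EReal)
  rw [sub_eq_add_neg, EReal.coe_add, EReal.le_add_coe_iff_add_neg_le, neg_neg]

/-- For every `δ` the decisions eventually enter the closed sublevel set at level `v + δ`, so a
cluster point lies in all of these sets. -/
theorem Run.Generated.isMinOn_of_mapClusterPt {R : P.Run} (hR : R.Generated) (hT : 1 ≤ P.T)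
    (hlaw : P.StageLaws) (hρ : ∀ t, 1 ≤ t → t < P.T → IsCoherent (P.ρ t)) (hreg : P.Regular)
    (hν : R.IsAsymptoticallyExact P.node₁) {y : Dec P.n}
    (hy : MapClusterPt y Filter.atTop (fun k => R.x k 0 P.node₁)) :
    y ∈ P.feasible 0 P.j₁ P.h₀ ∧
      IsMinOn (P.objective 0 (P.recourse 1) P.j₁ P.h₀) (P.feasible 0 P.j₁ P.h₀) y := by
  obtain ⟨v, hv⟩ := exists_optimalValue_eq hT hlaw hρ hreg
  have key : ∀ δ > 0, y ∈ P.feasible 0 P.j₁ P.h₀ ∧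
      P.objective 0 (P.recourse 1) P.j₁ P.h₀ y ≤ ((v + δ : ℝ) : EReal) := by
    intro δ hδ
    refine (isClosed_first_sublevel hT hlaw hρ hreg (v + δ)).mem_of_mapClusterPt hy ?_
    have h1 := hR.objective_first_le hT hν hδ
    rw [← Filter.map_add_atTop_eq_nat 1, Filter.eventually_map]
    filter_upwards [h1] with k hk
    refine ⟨hR.first_mem_feasible hT k, hk.trans ?_⟩
    rw [EReal.coe_add, ← hv]
    exact add_le_add_left (hR.firstValue_le hT hlaw hρ hreg k) _
  refine ⟨(key 1 one_pos).1, fun y' hy' => ?_⟩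
  have h2 : P.optimalValue ≤ P.objective 0 (P.recourse 1) P.j₁ P.h₀ y' := iInf₂_le y' hy'
  refine le_trans ?_ h2
  rw [hv]
  by_contra! hlt
  obtain ⟨a, hva, ha⟩ := EReal.lt_iff_exists_real_btwn.1 hlt
  have h3 := (key (a - v) (sub_pos.2 (EReal.coe_lt_coe_iff.1 hva))).2
  rw [add_sub_cancel] at h3
  exact absurd h3 (not_le.2 ha)

end StochProgram

theorem theorem1 (P : StochProgram) (hT : 1 ≤ P.T)
    (hlaw : P.StageLaws) (hρ : ∀ t, 1 ≤ t → t < P.T → IsCoherent (P.ρ t)) (hreg : P.Regular)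
    {Ω : Type*} [MeasurableSpace Ω] (ℙ : MeasureTheory.Measure Ω)
    [MeasureTheory.IsProbabilityMeasure ℙ] (R : Ω → P.Run)
    (hsamp : StochProgram.IndependentSampling R ℙ) (hna : StochProgram.NonAnticipative R)
    (hrun : ∀ ω, (R ω).Generated) :
    (∀ᵐ ω ∂ℙ, ∀ t, 1 ≤ t → t ≤ P.T → ∀ ν : P.Node t,
      Filter.Tendsto
        (fun k => P.recourse t ((R ω).hist k ν) - (R ω).approx k t ((R ω).hist k ν))
        Filter.atTop (nhds 0)) ∧
    (∀ᵐ ω ∂ℙ,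
      Filter.Tendsto (fun k => (R ω).firstValue k) Filter.atTop (nhds P.optimalValue)) ∧
    (ContinuousOn (fun y => P.f 0 (P.h₀.snoc y) (P.Ψ 0 P.j₁)) (P.X 0) →
      ∀ᵐ ω ∂ℙ, ∀ y : Dec P.n,
        MapClusterPt y Filter.atTop (fun k => (R ω).x k 0 P.node₁) →
          y ∈ P.feasible 0 P.j₁ P.h₀ ∧
          IsMinOn (P.objective 0 (P.recourse 1) P.j₁ P.h₀) (P.feasible 0 P.j₁ P.h₀) y) := by
  have hexact : ∀ᵐ ω ∂ℙ, ∀ t, 1 ≤ t → t ≤ P.T → ∀ ν : P.Node t,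
      (R ω).IsAsymptoticallyExact ν := by
    filter_upwards [StochProgram.ae_isRevisited hlaw hreg hsamp hna hrun] with ω hω t h1 ht ν
    exact (hrun ω).isAsymptoticallyExact hlaw hρ hreg hω h1 ht ν
  refine ⟨?_, ?_, fun _ => ?_⟩
  · filter_upwards [hexact] with ω hω t h1 ht ν
    exact (hrun ω).tendsto_gap hlaw hρ hreg h1 ht (hω t h1 ht ν)
  · filter_upwards [hexact] with ω hω
    exact (hrun ω).tendsto_firstValue hT hlaw hρ hreg (hω 1 le_rfl hT _)
  · filter_upwards [hexact] with ω hω y hy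
    exact (hrun ω).isMinOn_of_mapClusterPt hT hlaw hρ hreg (hω 1 le_rfl hT _) hy
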